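/- **Setting.** Let $S,U^p,U^a$ be finite nonempty sets, $p(\cdot\mid\theta,u^p,u^a)$ a transition kernel on $S$ and $\kappa:S\times U^p\times U^a\to\mathbb R^d$ a reward function. Let $K\subset\mathbb R^d$ be compact and contain the convex hull of the range of $\kappa$ (so that averages of rewards lie in $K$), and let $D\subset K$ be nonempty with convex closure $\bar D$. Let $\Pi^p$ (resp. $\Pi^a$) be the set of maps from $S$ to probability distributions on $U^p$ (resp. $U^a$). Assume that for all fixed $\pi^p\in\Pi^p$, $\pi^a\in\Pi^a$ the induced Markov chain on $S$ is ergodic (irreducibility suffices), with stationary distribution $\eta^{(\pi^p,\pi^a)}$, and put $$\bar\kappa(\pi^p,\pi^a)=\sum_{\theta,u^p,u^a}\kappa(\theta,u^p,u^a)\,\eta^{(\pi^p,\pi^a)}(\theta)\,\pi^p(u^p|\theta)\,\pi^a(u^a|\theta),\qquad R(\pi^p)=\{\bar\kappa(\pi^p,\pi^a):\pi^a\in\Pi^a\}.$$ For $x\in\mathbb R^d$ let $x_{\bar D}$ be the point of $\bar D$ closest to $x$. Assume that for every $x\in K\setminus\bar D$ there is $\pi^p_x\in\Pi^p$ with $\inf_{\pi^a}\langle\bar\kappa(\pi^p_x,\pi^a)-x_{\bar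 D},\,x_{\bar D}-x\rangle>0$. **Scheme.** A scheme consists of the following choices: a strategy $\pi^p_0\in\Pi^p$; for each $x\in K\setminus\bar D$ a strategy $\pi^p_x$ and a radius $\rho(x)>0$ with $\inf_{y\in B(x,\rho(x))}\inf_{\pi^a}\langle\bar\kappa(\pi^p_x,\pi^a)-y_{\bar D},\,y_{\bar D}-y\rangle>0$; for each $n\ge0$ a finite set $\mathcal Q_n\subset K_n:=\{y\in K:\operatorname{dist}(y,D)\in[\frac1{n+1},\frac1n]\}$ (with $\frac10=\infty$) such that the balls $B(q,\rho(q)/2)$, $q\in\mathcal Q_n$, cover $K_n$; an injection $I:\mathcal Q:=\bigcup_n\mathcal Q_n\to\mathbb N$; and durations $T(q)$, $q\in\mathcal Q$, with $\frac{\rho(q)}{4v_{\max}}<T(q)<\frac{\rho(q)}{3v_{\max}}$, where $v_{\max}=\sup_{x\in K,\theta,u^p,u^a}\|\kappa(\theta,u^p,u^a)-x\|$. For $x\in K\setminus\bar D$ let $Q(x)$ be the $q\in\mathcal Q$ of least $I(q)$ with $x\in B(q,\rho(q)/2)$. **Play.** The average reward is $x_{n+1}=x_n+\frac1{n+1}[\kappa(\theta_n,u^p_n,u^a_n)-x_n]$,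 $x_0\in K$. The switching times are $s_0=0$ and: if $x_{s_n}\in\bar D$, the player uses $\pi^p_0$ at time $s_n$ and $s_{n+1}=s_n+1$; if $x_{s_n}\notin\bar D$, then with $q=Q(x_{s_n})$ he uses $\pi^p_q$ at the times $s_n,\dots,s_{n+1}-1$, where $s_{n+1}=\min\{m:\sum_{i=s_n}^{m-1}\frac1i>T(q)\}$ (the term $i=0$ is omitted). At each time the adversary chooses a strategy in $\Pi^a$ depending arbitrarily on the past (states up to and actions before that time, and possibly private randomness); given the past, the two actions are drawn independently from the current strategies, and then the next state from $p$. **Exceptional set.** Let $t(n)=\sum_{i=1}^n\frac1i$, let $\bar x$ be the linear interpolation with $\bar x(t(n))=x_n$, and for $t\ge0$ put $\bar y_m(t)=\bar x(\min\{t(s_m)+t,\;t(s_{m+1})\})$. For $q\in\mathcal Q$, $k\ge0$, $0\le j<2^k$ and $h=2^{-k}T(q)$, let $N(q,j,k)$ be the set of sequences $(x_n)$ for which there are a subsequence $(s_{m(n)})$ of the switching times with $x_{s_{m(n)}}\in K\setminus\bar D$ and $Q(x_{s_{m(n)}})=q$ for all $n$, and a limit $\bar y$ of $\bar y_{m(n)}$,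 uniform on compact subsets of $[0,\infty)$, such that $$\frac{\bar y((j+1)h)-e^{-h}\,\bar y(jh)}{1-e^{-h}}\notin\overline{R(\pi^p_q)}.$$ Let $N=\bigcup_{q,k,j}N(q,j,k)$. **Theorem.** A scheme exists. If the player follows any scheme, then, whatever the adversary does, almost surely $(x_n)\notin N$; and whenever $(x_n)\notin N$, every limit point of $(x_n)$ lies in $\bar D$. In particular, almost surely every limit point of the average reward $(x_n)$ lies in $\bar D$. -/

import Mathlib

open MeasureTheory Filter Topology

noncomputable section

namespace Approach

/-- The reward space `ℝ^d` with its Euclidean norm and inner product. -/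
abbrev Vec (d : ℕ) : Type := EuclideanSpace ℝ (Fin d)

/-- A (stationary, randomized) strategy: each state is mapped to a probability
distribution on the action set `U`. -/
abbrev Strategy (S U : Type*) [Fintype U] : Type _ := S → stdSimplex ℝ U

/-- The data of the problem: the transition kernel `p(· | θ, a, b)`, the one-step reward
`κ(θ, a, b)`, the reward set `K` and the target set `D`. -/
structure Game (S Up Ua : Type*) [Fintype S] (d : ℕ) where
  p : S → Up → Ua → stdSimplex ℝ S
  κ : S → Up → Ua → Vec d
  K : Set (Vec d)
  D : Set (Vec d)

namespace Game

variable {S Up Ua : Type*} [Fintype S] [Fintype Up] [Fintype Ua] {d : ℕ}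
variable (G : Game S Up Ua d)

/-- The transition matrix of the state when both players use fixed strategies. -/
def transition (πp : Strategy S Up) (πa : Strategy S Ua) : Matrix S S ℝ :=
  fun θ θ' => ∑ a, ∑ b, πp θ a * πa θ b * G.p θ a b θ'

/-- `η` is a stationary probability vector of the matrix `P`. -/
def IsStationary (P : Matrix S S ℝ) (η : S → ℝ) : Prop :=
  η ∈ stdSimplex ℝ S ∧ Matrix.vecMul η P = η

open Classical in
/-- The stationary distribution `η^{(πp, πa)}`. It exists for every stochastic matrix, and is
unique when the chain is irreducible. -/
def stationary (πp : Strategy S Up) (πa : Strategy S Ua) : S → ℝ :=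
  if h : ∃ η, IsStationary (G.transition πp πa) η then h.choose else 0

/-- The long-run average reward `κ̄(πp, πa)`. -/
def meanReward (πp : Strategy S Up) (πa : Strategy S Ua) : Vec d :=
  ∑ θ, ∑ a, ∑ b, (G.stationary πp πa θ * πp θ a * πa θ b) • G.κ θ a b

/-- The set `R(πp)` of long-run average rewards against all adversary strategies. -/
def rewardSet (πp : Strategy S Up) : Set (Vec d) :=
  Set.range fun πa : Strategy S Ua => G.meanReward πp πa

/-- Ergodicity for every fixed pair of strategies, in the sense of irreducibility
(aperiodicity is not required). -/
def Ergodic : Prop :=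
  ∀ (πp : Strategy S Up) (πa : Strategy S Ua), (G.transition πp πa).IsIrreducible

/-- `x_{D̄}`: the point of the closure of `D` closest to `x` (it exists and is unique when `D` is
nonempty with convex closure). -/
def proj (x : Vec d) : Vec d :=
  Classical.epsilon fun y => y ∈ closure G.D ∧ ∀ z ∈ closure G.D, ‖x - y‖ ≤ ‖x - z‖

/-- The separation assumption: for every `x ∈ K \ D̄` some player strategy `πp` satisfies
`inf_{πa} ⟪κ̄(πp, πa) - x_{D̄}, x_{D̄} - x⟫ > 0`. -/
def Separation : Prop :=
  ∀ x ∈ G.K \ closure G.D, ∃ πp : Strategy S Up, ∃ ε > 0, ∀ πa : Strategy S Ua,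
    ε ≤ inner ℝ (G.meanReward πp πa - G.proj x) (G.proj x - x)

/-- The layer `K_n = {y ∈ K : dist(y, D) ∈ [1/(n+1), 1/n]}`, where `1/0 = ∞`, so that the
layers cover `K \ D̄`. -/
def layer (n : ℕ) : Set (Vec d) :=
  {y ∈ G.K | 1 / ((n : ℝ) + 1) ≤ Metric.infDist y G.D ∧
    (n ≠ 0 → Metric.infDist y G.D ≤ 1 / (n : ℝ))}

/-- `v_max = sup_{x ∈ K} sup_{θ, a, b} ‖κ(θ, a, b) - x‖`. -/
def vmax : ℝ :=
  sSup {r : ℝ | ∃ x ∈ G.K, ∃ θ a b, r = ‖G.κ θ a b - x‖}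

end Game

/-- The harmonic rescaled times `t(n) = ∑_{i=1}^n 1/i`. -/
def rescaledTime (n : ℕ) : ℝ := ∑ i ∈ Finset.Icc 1 n, 1 / (i : ℝ)

/-- The running averages `x_{n+1} = x_n + (r_n - x_n)/(n+1)` started at `x₀`. -/
def average {d : ℕ} (x₀ : Vec d) (r : ℕ → Vec d) : ℕ → Vec d
  | 0 => x₀
  | n + 1 => average x₀ r n + (1 / ((n : ℝ) + 1)) • (r n - average x₀ r n)

/-- The linear interpolation `x̄(t)`, `t ≥ 0`, of a sequence `(x_n)`, with `x̄(t(n)) = x_n`: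
here `n` is the index with `t ∈ [t(n), t(n+1))`. -/
def interpolate {d : ℕ} (x : ℕ → Vec d) (t : ℝ) : Vec d :=
  let n : ℕ := sInf {n : ℕ | t < rescaledTime (n + 1)}
  ((rescaledTime (n + 1) - t) / (rescaledTime (n + 1) - rescaledTime n)) • x n +
    ((t - rescaledTime n) / (rescaledTime (n + 1) - rescaledTime n)) • x (n + 1)

/-- The choices that the player makes to set up the scheme. Functions on `K \ D̄` or on the
countable set of centres are total functions, constrained only there. -/
structure Scheme {S Up Ua : Type*} [Fintype S] [Fintype Up] [Fintype Ua] {d : ℕ}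
    (G : Game S Up Ua d) where
  /-- the strategy `π^p_x` for `x ∈ K \ D̄` -/
  strat : Vec d → Strategy S Up
  /-- the arbitrary strategy `π^p_0` used from points of `D̄` -/
  strat₀ : Strategy S Up
  /-- the radii `ρ(x)` -/
  ρ : Vec d → ℝ
  ρ_pos : ∀ x ∈ G.K \ closure G.D, 0 < ρ x
  /-- `inf_{y ∈ B(x, ρ(x))} inf_{πa} ⟪κ̄(π^p_x, πa) - y_{D̄}, y_{D̄} - y⟫ > 0` -/
  separates : ∀ x ∈ G.K \ closure G.D, ∃ ε > 0, ∀ y ∈ Metric.ball x (ρ x),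
    ∀ πa : Strategy S Ua,
      ε ≤ inner ℝ (G.meanReward (strat x) πa - G.proj y) (G.proj y - y)
  /-- the finite sets `𝒬_n` -/
  net : ℕ → Finset (Vec d)
  net_subset : ∀ n, (net n : Set (Vec d)) ⊆ G.layer n
  net_covers : ∀ n, G.layer n ⊆ ⋃ q ∈ net n, Metric.ball q (ρ q / 2)
  /-- the enumeration `I` of `𝒬 = ⋃ 𝒬_n` -/
  index : Vec d → ℕ
  index_injOn : Set.InjOn index (⋃ n, (net n : Set (Vec d)))
  /-- the rescaled holding durations `T(q)` -/
  T : Vec d → ℝ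
  T_bounds : ∀ q ∈ ⋃ n, (net n : Set (Vec d)),
    ρ q / (4 * G.vmax) < T q ∧ T q < ρ q / (3 * G.vmax)

namespace Scheme

variable {S Up Ua : Type*} [Fintype S] [Fintype Up] [Fintype Ua] {d : ℕ}
variable {G : Game S Up Ua d} (C : Scheme G)

/-- The countable set `𝒬 = ⋃ 𝒬_n` of centres. -/
def centres : Set (Vec d) := ⋃ n, (C.net n : Set (Vec d))

open Classical in
/-- `Q(x)`: the centre `q` of least index `I(q)` with `x ∈ B(q, ρ(q)/2)`. One exists for every
`x ∈ K \ D̄`; elsewhere the value is not used. -/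
def Q (x : Vec d) : Vec d :=
  if h : {q ∈ C.centres | x ∈ Metric.ball q (C.ρ q / 2)}.Nonempty
  then Function.argminOn C.index {q ∈ C.centres | x ∈ Metric.ball q (C.ρ q / 2)} h
  else x

open Classical in
/-- The switching time that follows a switching time `s`: if `x_s ∈ D̄` it is `s + 1`, and
otherwise the least `m` with `∑_{i=s}^{m-1} 1/i > T(Q(x_s))`; for `s = 0` the undefined
term `1/0` is left out of the sum. -/
def nextSwitch (x : ℕ → Vec d) (s : ℕ) : ℕ :=
  if x s ∈ closure G.D then s + 1
  else sInf {m : ℕ | C.T (C.Q (x s)) < ∑ i ∈ Finset.Ico (max s 1) m, 1 / (i : ℝ)}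

/-- The switching times `s_0 = 0 < s_1 < s_2 < …` along the sequence `(x_n)`. -/
def switchTime (x : ℕ → Vec d) : ℕ → ℕ
  | 0 => 0
  | n + 1 => C.nextSwitch x (switchTime x n)

/-- The number `k` of the holding period that contains time `n`: `s_k ≤ n < s_{k+1}`
(`k ≤ n`, since the switching times are strictly increasing). -/
def period (x : ℕ → Vec d) (n : ℕ) : ℕ :=
  Nat.findGreatest (fun k => C.switchTime x k ≤ n) n

open Classical in
/-- The strategy that the scheme prescribes at time `n`: chosen at the last switching time `s ≤ n`,
it is `π^p_q` with `q = Q(x_s)` if `x_s ∉ D̄`, and `π^p_0` if `x_s ∈ D̄`. -/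
def playerStrategy (x : ℕ → Vec d) (n : ℕ) : Strategy S Up :=
  let s := C.switchTime x (C.period x n)
  if x s ∈ closure G.D then C.strat₀ else C.strat (C.Q (x s))

/-- The trajectory `ȳ_m` on `[0, ∞)`: `x̄` shifted to start at time `t(s_m)` and frozen from
the time `t(s_{m+1})` on. -/
def trajectory (x : ℕ → Vec d) (m : ℕ) (t : ℝ) : Vec d :=
  if t ≤ rescaledTime (C.switchTime x (m + 1)) - rescaledTime (C.switchTime x m)
  then interpolate x (rescaledTime (C.switchTime x m) + t)
  else interpolate x (rescaledTime (C.switchTime x (m + 1)))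

/-- The vector `κ_{j,k}` of a trajectory `y` on `[0, T]`:
`(y(2^{-k}(j+1)T) - e^{-2^{-k}T} y(2^{-k}jT)) / (1 - e^{-2^{-k}T})`. -/
def dyadicReward (y : ℝ → Vec d) (T : ℝ) (j k : ℕ) : Vec d :=
  let h : ℝ := T / 2 ^ k
  (1 - Real.exp (-h))⁻¹ • (y (((j : ℝ) + 1) * h) - Real.exp (-h) • y ((j : ℝ) * h))

/-- `N(q, j, k)`: the sequences `(x_n)` with a subsequence `(s_{m(n)})` of switching times such that
`x_{s_{m(n)}} ∈ K \ D̄` and `Q(x_{s_{m(n)}}) = q` for all `n`, and whose trajectories `ȳ_{m(n)}`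
converge, uniformly on compacts of `[0, ∞)`, to a limit `y` with `κ_{j,k} ∉ closure R(π^p_q)`. -/
def exceptionalAt (q : Vec d) (j k : ℕ) : Set (ℕ → Vec d) :=
  {x | ∃ m : ℕ → ℕ, StrictMono m ∧
    (∀ n, x (C.switchTime x (m n)) ∈ G.K \ closure G.D ∧ C.Q (x (C.switchTime x (m n))) = q) ∧
    ∃ y : ℝ → Vec d,
      (∀ b : ℝ, TendstoUniformlyOn (fun n => C.trajectory x (m n)) y atTop (Set.Icc 0 b)) ∧
      dyadicReward y (C.T q) j k ∉ closure (G.rewardSet (C.strat q))}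

/-- The exceptional set `N = ⋃_q ⋃_k ⋃_{j < 2^k} N(q, j, k)`. -/
def exceptional : Set (ℕ → Vec d) :=
  ⋃ q ∈ C.centres, ⋃ k : ℕ, ⋃ j ∈ Finset.range (2 ^ k), C.exceptionalAt q j k

/-- The running averages `(x_n)` of the realized rewards, with initial value `x₀`, in the
outcome `ω`. -/
def path (_C : Scheme G) {Ω : Type*} (x₀ : Vec d) (θ : ℕ → Ω → S) (up : ℕ → Ω → Up)
    (ua : ℕ → Ω → Ua) (ω : Ω) : ℕ → Vec d :=
  average x₀ fun n => G.κ (θ n ω) (up n ω) (ua n ω)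

/-- `(θ_n, u^p_n, u^a_n)` is a play of the controlled chain in which the player follows the
scheme. The σ-algebra `ℱ n` is the past available at time `n`: it determines the states up to time
`n` and the actions before time `n`, and possibly private randomness. The adversary picks any
strategy `πa n` depending on the past; given the past, the two actions are drawn independently from
the current strategies, and the next state from the kernel. -/
structure IsPlay {Ω : Type*} [mΩ : MeasurableSpace Ω] (μ : Measure Ω) (ℱ : Filtration ℕ mΩ)
    (x₀ : Vec d) (θ : ℕ → Ω → S) (up : ℕ → Ω → Up) (ua : ℕ → Ω → Ua)
    (πa : ℕ → Ω → Strategy S Ua) : Prop where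
  state_meas : ∀ n s, MeasurableSet[ℱ n] {ω | θ n ω = s}
  player_meas : ∀ n a, MeasurableSet[ℱ (n + 1)] {ω | up n ω = a}
  adversary_meas : ∀ n b, MeasurableSet[ℱ (n + 1)] {ω | ua n ω = b}
  strategy_meas : ∀ n s b, Measurable[ℱ n] fun ω => πa n ω s b
  step : ∀ n a b s,
    μ[Set.indicator {ω | up n ω = a ∧ ua n ω = b ∧ θ (n + 1) ω = s} (fun _ => (1 : ℝ)) | ℱ n]
      =ᵐ[μ] fun ω =>
        C.playerStrategy (C.path x₀ θ up ua ω) n (θ n ω) a * πa n ω (θ n ω) b *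
          G.p (θ n ω) a b s

end Scheme

end Approach

end

/-! The proof has a probabilistic and a deterministic half, which meet at the exceptional set.

Probabilistic half. The indicator of a transition (s, a, b, s') minus its conditional probability is
a bounded martingale difference, so by the strong law these deviations sum to o(n) almost surely. A
stretch of rescaled time of length h is an index window [M, N) with M/N → e^{-h}; it fills a
positive fraction of [0, N), so the o(n) error stays negligible on it. On windows where the player
holds π^p_q, limits of the occupation measures are therefore balanced. Disintegrating such a limit
yields a stationary adversary strategy, and uniqueness of the stationary distribution puts the
limiting window reward in R(π^p_q) (`mem_rewardSet_of_tendsto_window`). Since n x_n is the sum of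
the rewards, this limit is exactly the vector tested in N (`dyadicReward_mem_rewardSet`).

Deterministic half. Off N, a dyadic step of a limit trajectory leads from z to e^{-h} z + (1 -
e^{-h}) r with r in the closure of R(π^p_q). Separation makes the squared distance to D fall by 2εh
- O(h²), and fine steps add up to a drop of at least εT(q) (`infDist_sq_le_of_dyadicReward`). By
Arzelà–Ascoli, late holding periods with centre q lower the squared distance by a fixed amount
(`eventually_infDist_sq_le_of_centre`). Away from D only finitely many centres occur, so the drop is
uniform there, while a single period inflates the distance at most by the factor 5/3 and a vanishing
error. Hence the distance tends to 0 (`tendsto_infDist`).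

A scheme exists because the projection is continuous, which spreads separation to balls, and because
the layers are compact. -/

noncomputable section

namespace Approach

/-! ### Strong law for bounded martingale differences -/

section StrongLaw

variable {Ω : Type*} {mΩ : MeasurableSpace Ω} {μ : Measure Ω} {ℱ : Filtration ℕ mΩ}

/-- A form of Kronecker's lemma. -/
theorem tendsto_sum_div_of_tendsto_sum_weighted {ξ : ℕ → ℝ} {c : ℝ}
    (h : Tendsto (fun n => ∑ i ∈ Finset.range n, ξ i / ((i : ℝ) + 1)) atTop (𝓝 c)) :
    Tendsto (fun n : ℕ => (∑ i ∈ Finset.range n, ξ i) / (n : ℝ)) atTop (𝓝 0) := by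
  set Z : ℕ → ℝ := fun n => ∑ i ∈ Finset.range n, ξ i / ((i : ℝ) + 1) with hZ
  -- Summation by parts. Divided by n, the right side is `Z n` minus the Cesàro mean of the earlier
  -- values, and both tend to c.
  have key : ∀ n : ℕ, ∑ i ∈ Finset.range n, ξ i = n * Z n - ∑ i ∈ Finset.range n, Z i := by
    intro n
    induction n with
    | zero => simp
    | succ n ih =>
      have h1 : Z (n + 1) = Z n + ξ n / ((n : ℝ) + 1) := by
        simp [hZ, Finset.sum_range_succ]
      rw [Finset.sum_range_succ, Finset.sum_range_succ, ih, h1]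
      have : (n : ℝ) + 1 ≠ 0 := by positivity
      push_cast
      field_simp
      ring
  have h2 := h.sub h.cesaro
  rw [sub_self] at h2
  refine h2.congr' ?_
  filter_upwards [eventually_gt_atTop 0] with n hn
  rw [key n]
  have : (n : ℝ) ≠ 0 := by positivity
  field_simp

/-- Orthogonality of a martingale increment to the past: Z can be pulled out of the conditional
expectation. -/
theorem integral_mul_eq_zero_of_condExp_eq_zero [IsFiniteMeasure μ] {m : MeasurableSpace Ω}
    (hm : m ≤ mΩ) {Z ξ : Ω → ℝ} (hZ : StronglyMeasurable[m] Z) (hξ : Integrable ξ μ)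
    (hZξ : Integrable (fun ω => Z ω * ξ ω) μ) (h0 : μ[ξ | m] =ᵐ[μ] 0) :
    ∫ ω, Z ω * ξ ω ∂μ = 0 := by
  have h1 : μ[fun ω => Z ω * ξ ω | m] =ᵐ[μ] fun ω => Z ω * (μ[ξ | m]) ω :=
    condExp_mul_of_stronglyMeasurable_left hZ hZξ hξ
  rw [← integral_condExp hm (f := fun ω => Z ω * ξ ω)]
  refine integral_eq_zero_of_ae ?_
  filter_upwards [h1, h0] with ω h1 h0
  rw [h1, h0]
  simp

/-- Strong law of large numbers for bounded martingale differences. -/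
theorem ae_tendsto_sum_div_of_martingaleDifference [IsProbabilityMeasure μ] {ξ : ℕ → Ω → ℝ} {C : ℝ}
    (hmeas : ∀ n, StronglyMeasurable[ℱ (n + 1)] (ξ n)) (hC : ∀ n, ∀ᵐ ω ∂μ, |ξ n ω| ≤ C)
    (h0 : ∀ n, μ[ξ n | ℱ n] =ᵐ[μ] 0) :
    ∀ᵐ ω ∂μ, Tendsto (fun n : ℕ => (∑ i ∈ Finset.range n, ξ i ω) / (n : ℝ)) atTop (𝓝 0) := by
  have hC' : ∀ᵐ ω ∂μ, ∀ n, |ξ n ω| ≤ C := ae_all_iff.2 hC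
  have hmeasΩ : ∀ n, StronglyMeasurable (ξ n) := fun n => (hmeas n).mono (ℱ.le _)
  have hint : ∀ n, Integrable (ξ n) μ := fun n =>
    Integrable.of_bound (hmeasΩ n).aestronglyMeasurable C (by simpa using hC n)
  -- The weights 1/(i+1) are square summable, so this martingale is bounded in L², hence in L¹, and
  -- converges almost surely; Kronecker's lemma then returns to plain averages.
  set Z : ℕ → Ω → ℝ := fun n ω => ∑ i ∈ Finset.range n, ξ i ω / ((i : ℝ) + 1) with hZ
  have hZs : ∀ n ω, Z (n + 1) ω = Z n ω + ξ n ω / ((n : ℝ) + 1) := fun n ω => by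
    simp [hZ, Finset.sum_range_succ]
  have hZm : ∀ n, StronglyMeasurable[ℱ n] (Z n) := by
    intro n
    refine Finset.stronglyMeasurable_fun_sum _ fun i hi => ?_
    have : StronglyMeasurable[ℱ n] (ξ i) :=
      (hmeas i).mono (ℱ.mono (Finset.mem_range.1 hi))
    simpa [div_eq_mul_inv] using this.mul_const (((i : ℝ) + 1)⁻¹)
  have hZb : ∀ n, ∃ B, ∀ᵐ ω ∂μ, |Z n ω| ≤ B := by
    intro n
    refine ⟨∑ i ∈ Finset.range n, C / ((i : ℝ) + 1), ?_⟩
    filter_upwards [hC'] with ω hω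
    refine (Finset.abs_sum_le_sum_abs _ _).trans (Finset.sum_le_sum fun i _ => ?_)
    rw [abs_div, abs_of_pos (show (0 : ℝ) < (i : ℝ) + 1 by positivity)]
    have := hω i
    gcongr
  have hZmΩ : ∀ n, StronglyMeasurable (Z n) := fun n => (hZm n).mono (ℱ.le _)
  have hZint : ∀ n, Integrable (Z n) μ := fun n => by
    obtain ⟨B, hB⟩ := hZb n
    exact Integrable.of_bound (hZmΩ n).aestronglyMeasurable B (by simpa using hB)
  have hZ2int : ∀ n, Integrable (fun ω => Z n ω ^ 2) μ := fun n => by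
    obtain ⟨B, hB⟩ := hZb n
    refine Integrable.of_bound ((hZmΩ n).pow 2).aestronglyMeasurable (B ^ 2) ?_
    filter_upwards [hB] with ω hω
    rw [Real.norm_eq_abs, abs_pow]
    gcongr
  have hξ2int : ∀ n, Integrable (fun ω => ξ n ω ^ 2) μ := fun n => by
    refine Integrable.of_bound ((hmeasΩ n).pow 2).aestronglyMeasurable (C ^ 2) ?_
    filter_upwards [hC n] with ω hω
    rw [Real.norm_eq_abs, abs_pow]
    gcongr
  have hZξint : ∀ n, Integrable (fun ω => Z n ω * ξ n ω) μ := fun n => by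
    obtain ⟨B, hB⟩ := hZb n
    refine Integrable.of_bound ((hZmΩ n).mul (hmeasΩ n)).aestronglyMeasurable (B * C) ?_
    filter_upwards [hB, hC n] with ω h1 h2
    rw [Real.norm_eq_abs, abs_mul]
    have := abs_nonneg (Z n ω)
    gcongr
    exact this.trans h1
  have hξ2 : ∀ n, ∫ ω, ξ n ω ^ 2 ∂μ ≤ C ^ 2 := fun n => by
    have : ∫ ω, ξ n ω ^ 2 ∂μ ≤ ∫ _, C ^ 2 ∂μ := by
      refine integral_mono_ae (hξ2int n) (integrable_const _) ?_
      filter_upwards [hC n] with ω hω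
      simpa using sq_le_sq' (neg_le_of_abs_le hω) (le_of_abs_le hω)
    simpa using this
  have hZ2 : ∀ n, ∫ ω, Z n ω ^ 2 ∂μ ≤ ∑ i ∈ Finset.range n, C ^ 2 / ((i : ℝ) + 1) ^ 2 := by
    intro n
    induction n with
    | zero => simp [hZ]
    | succ n ih =>
      have e : ∀ ω, Z (n + 1) ω ^ 2 = Z n ω ^ 2 + (2 / ((n : ℝ) + 1)) * (Z n ω * ξ n ω)
          + (1 / ((n : ℝ) + 1) ^ 2) * ξ n ω ^ 2 := fun ω => by
        rw [hZs]; field_simp; ring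
      have hI : Integrable (fun ω => Z n ω ^ 2 + (2 / ((n : ℝ) + 1)) * (Z n ω * ξ n ω)) μ :=
        (hZ2int n).add ((hZξint n).const_mul _)
      simp_rw [e]
      rw [integral_add hI ((hξ2int n).const_mul _),
        integral_add (hZ2int n) ((hZξint n).const_mul _), integral_const_mul, integral_const_mul,
        integral_mul_eq_zero_of_condExp_eq_zero (ℱ.le n) (hZm n) (hint n) (hZξint n) (h0 n),
        Finset.sum_range_succ, mul_zero, add_zero]
      refine add_le_add ih ?_
      rw [div_mul_eq_mul_div, one_mul]
      gcongr
      exact hξ2 n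
  have hsum : Summable fun i : ℕ => C ^ 2 / ((i : ℝ) + 1) ^ 2 := by
    have := ((summable_nat_add_iff 1).2 (Real.summable_one_div_nat_pow.2 one_lt_two)).mul_left (C ^ 2)
    refine this.congr fun i => ?_
    push_cast
    ring
  have hmart : Martingale Z ℱ μ := by
    refine martingale_of_condExp_sub_eq_zero_nat hZm hZint fun n => ?_
    have e : Z (n + 1) - Z n = (((n : ℝ) + 1)⁻¹) • ξ n := by
      ext ω
      simp only [Pi.sub_apply, Pi.smul_apply, smul_eq_mul, hZs]
      ring
    rw [e]
    filter_upwards [condExp_smul (μ := μ) (((n : ℝ) + 1)⁻¹) (ξ n) (ℱ n), h0 n] with ω h1 h2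
    rw [h1, Pi.smul_apply, h2]
    simp
  have hbdd : ∀ n, eLpNorm (Z n) 1 μ ≤
      (Real.toNNReal (1 + ∑' i : ℕ, C ^ 2 / ((i : ℝ) + 1) ^ 2) : NNReal) := by
    intro n
    rw [eLpNorm_one_eq_lintegral_enorm, ← ofReal_integral_norm_eq_lintegral_enorm (hZint n)]
    refine ENNReal.ofReal_le_ofReal ?_
    calc ∫ ω, ‖Z n ω‖ ∂μ ≤ ∫ ω, (1 + Z n ω ^ 2) ∂μ := by
          refine integral_mono (hZint n).norm ((integrable_const _).add (hZ2int n)) fun ω => ?_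
          simp only [Real.norm_eq_abs]
          nlinarith [sq_abs (Z n ω), sq_nonneg (|Z n ω| - 1)]
      _ = 1 + ∫ ω, Z n ω ^ 2 ∂μ := by
          rw [integral_add (integrable_const _) (hZ2int n)]; simp
      _ ≤ _ := by
          gcongr
          exact (hZ2 n).trans (hsum.sum_le_tsum _ fun i _ => by positivity)
  filter_upwards [hmart.submartingale.exists_ae_tendsto_of_bdd hbdd] with ω ⟨c, hc⟩
  exact tendsto_sum_div_of_tendsto_sum_weighted hc

/-- Frequencies of adapted events are asymptotic to the averages of their conditional
probabilities. -/
theorem ae_tendsto_indicator_sub_condExp [IsProbabilityMeasure μ] {A : ℕ → Set Ω}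
    (hA : ∀ n, MeasurableSet[ℱ (n + 1)] (A n)) {f : ℕ → Ω → ℝ}
    (hf : ∀ n, μ[(A n).indicator (fun _ => (1 : ℝ)) | ℱ n] =ᵐ[μ] f n) :
    ∀ᵐ ω ∂μ, Tendsto (fun n : ℕ =>
      (∑ i ∈ Finset.range n, ((A i).indicator (fun _ => (1 : ℝ)) ω - f i ω)) / (n : ℝ))
      atTop (𝓝 0) := by
  have hAΩ : ∀ n, MeasurableSet (A n) := fun n => ℱ.le _ _ (hA n)
  have hint : ∀ n, Integrable ((A n).indicator (fun _ => (1 : ℝ))) μ := fun n =>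
    (integrable_const _).indicator (hAΩ n)
  have hb : ∀ n ω, |(A n).indicator (fun _ => (1 : ℝ)) ω| ≤ 1 := fun n ω => by
    by_cases h : ω ∈ A n <;> simp [h]
  have key := ae_tendsto_sum_div_of_martingaleDifference (μ := μ) (ℱ := ℱ) (C := 2)
    (ξ := fun n => (A n).indicator (fun _ => (1 : ℝ)) -
      μ[(A n).indicator (fun _ => (1 : ℝ)) | ℱ n]) ?_ ?_ ?_
  · filter_upwards [key, ae_all_iff.2 hf] with ω h1 h2
    simpa [h2] using h1
  · intro n
    exact (stronglyMeasurable_const.indicator (hA n)).sub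
      (stronglyMeasurable_condExp.mono (ℱ.mono n.le_succ))
  · intro n
    have := ae_bdd_abs_condExp_of_ae_bdd_abs (m := ℱ n) (μ := μ) (R := (1 : ℝ))
      (f := (A n).indicator (fun _ => (1 : ℝ))) (Eventually.of_forall fun ω => by simpa using hb n ω)
    filter_upwards [this] with ω hω
    refine (abs_sub _ _).trans ?_
    have := hb n ω
    have h1 : |(μ[(A n).indicator (fun _ => (1 : ℝ)) | ℱ n]) ω| ≤ 1 := by simpa using hω
    linarith
  · intro n
    filter_upwards [condExp_sub (hint n) integrable_condExp (ℱ n),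
      condExp_condExp_of_le (μ := μ) (le_refl (ℱ n)) (ℱ.le n)
        (f := (A n).indicator (fun _ => (1 : ℝ)))] with ω h1 h2
    rw [h1, Pi.sub_apply, h2]
    simp

end StrongLaw

/-! ### Stationary distributions and occupation measures -/

section Stationary

variable {S Up Ua : Type*} [Fintype S] [Fintype Up] [Fintype Ua] {d : ℕ}

/-- A row-stochastic irreducible matrix has no invariant vector of zero mass that is positive
somewhere. -/
theorem nonpos_of_vecMul_eq_self {P : Matrix S S ℝ} (hP : P.IsIrreducible)
    (hrow : ∀ i, ∑ j, P i j = 1) {g : S → ℝ} (hg : Matrix.vecMul g P = g) (hsum : ∑ i, g i = 0)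
    (i : S) : g i ≤ 0 := by
  classical
  by_contra! hi
  -- The positive part satisfies f ≤ fP, and both sides have the same mass, so f is invariant.
  -- Irreducibility spreads its positivity from i to every state; then g > 0 everywhere, against
  -- zero mass.
  set f : S → ℝ := fun j => max (g j) 0 with hf
  have hf0 : ∀ j, 0 ≤ f j := fun j => le_max_right _ _
  have hle : ∀ j, f j ≤ Matrix.vecMul f P j := by
    intro j
    refine max_le ?_ ?_
    · conv_lhs => rw [← hg]
      exact Finset.sum_le_sum fun k _ =>
        mul_le_mul_of_nonneg_right (le_max_left _ _) (hP.nonneg k j)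
    · exact Finset.sum_nonneg fun k _ => mul_nonneg (hf0 k) (hP.nonneg k j)
  have hmass : ∑ j, Matrix.vecMul f P j = ∑ j, f j := by
    simp only [Matrix.vecMul, dotProduct]
    rw [Finset.sum_comm]
    exact Finset.sum_congr rfl fun k _ => by rw [← Finset.mul_sum, hrow, mul_one]
  have hfP : Matrix.vecMul f P = f := by
    funext j
    exact ((Finset.sum_eq_sum_iff_of_le fun j _ => hle j).1 hmass.symm j (Finset.mem_univ j)).symm
  have hpow : ∀ k : ℕ, Matrix.vecMul f (P ^ k) = f := by
    intro k
    induction k with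
    | zero => simp
    | succ k ih => rw [pow_succ, ← Matrix.vecMul_vecMul, ih, hfP]
  have hpos : ∀ j, 0 < g j := by
    intro j
    obtain ⟨k, -, hk⟩ := (Matrix.isIrreducible_iff_exists_pow_pos hP.nonneg).1 hP i j
    have h1 : 0 < f j := by
      rw [← hpow k]
      have h2 : f i * (P ^ k) i j ≤ Matrix.vecMul f (P ^ k) j :=
        Finset.single_le_sum (f := fun l => f l * (P ^ k) l j)
          (fun l _ => mul_nonneg (hf0 l) (Matrix.pow_apply_nonneg hP.nonneg k l j))
          (Finset.mem_univ i)
      refine lt_of_lt_of_le (mul_pos ?_ hk) h2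
      exact lt_of_lt_of_le hi (le_max_left _ _)
    rcases lt_max_iff.1 h1 with h | h
    · exact h
    · exact absurd h (lt_irrefl _)
  have : 0 < ∑ j, g j := Finset.sum_pos (fun j _ => hpos j) ⟨i, Finset.mem_univ i⟩
  exact this.ne' hsum

/-- The difference of two stationary vectors is invariant of zero mass, so
`nonpos_of_vecMul_eq_self` applies to it and to its negative. -/
theorem Game.IsStationary.unique {P : Matrix S S ℝ} (hP : P.IsIrreducible)
    (hrow : ∀ i, ∑ j, P i j = 1) {η η' : S → ℝ} (h : Game.IsStationary P η)
    (h' : Game.IsStationary P η') : η = η' := by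
  have key : ∀ {η η' : S → ℝ}, Game.IsStationary P η → Game.IsStationary P η' →
      ∀ i, η i ≤ η' i := by
    intro η η' h h' i
    have := nonpos_of_vecMul_eq_self hP hrow (g := η - η')
      (by rw [Matrix.sub_vecMul, h.2, h'.2]) (by simp [h.1.2, h'.1.2]) i
    simpa using this
  exact funext fun i => le_antisymm (key h h' i) (key h' h i)

namespace Game

variable (G : Game S Up Ua d)

theorem transition_row_sum (πp : Strategy S Up) (πa : Strategy S Ua) (θ : S) :
    ∑ θ', G.transition πp πa θ θ' = 1 := by
  simp only [transition]
  rw [Finset.sum_comm]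
  have h1 : ∀ a, ∑ θ', ∑ b, πp θ a * πa θ b * G.p θ a b θ' = πp θ a := by
    intro a
    rw [Finset.sum_comm]
    simp_rw [← Finset.mul_sum]
    have : ∀ b, ∑ θ', G.p θ a b θ' = 1 := fun b => (G.p θ a b).2.2
    simp_rw [this, mul_one, ← Finset.mul_sum]
    have : ∑ b, πa θ b = 1 := (πa θ).2.2
    rw [this, mul_one]
  simp_rw [h1]
  exact (πp θ).2.2

/-- An occupation measure `ν` on states and adversary actions that is balanced under the player
strategy `πp` yields a point of `R(πp)`. -/
theorem sum_smul_mem_rewardSet [Nonempty Ua] (hG : G.Ergodic) (πp : Strategy S Up)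
    {ν : S → Ua → ℝ} (hν : ∀ s b, 0 ≤ ν s b) (hν1 : ∑ s, ∑ b, ν s b = 1)
    (hbal : ∀ s', ∑ b, ν s' b = ∑ s, ∑ a, ∑ b, πp s a * ν s b * G.p s a b s') :
    ∑ s, ∑ a, ∑ b, (πp s a * ν s b) • G.κ s a b ∈ G.rewardSet πp := by
  classical
  set η : S → ℝ := fun s => ∑ b, ν s b with hη
  -- Disintegration: w is the conditional law of the adversary's action given s. At states of mass
  -- zero any law serves, since ν vanishes there.
  have hex : ∀ s, ∃ w : stdSimplex ℝ Ua, ∀ b, ν s b = η s * w b := by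
    intro s
    by_cases h0 : η s = 0
    · refine ⟨Classical.arbitrary _, fun b => ?_⟩
      rw [h0, zero_mul]
      exact (Finset.sum_eq_zero_iff_of_nonneg fun b _ => hν s b).1 h0 b (Finset.mem_univ b)
    · have hpos : 0 < η s := lt_of_le_of_ne (Finset.sum_nonneg fun b _ => hν s b) (Ne.symm h0)
      refine ⟨⟨fun b => ν s b / η s, fun b => div_nonneg (hν s b) hpos.le, ?_⟩, fun b => ?_⟩
      · rw [← Finset.sum_div]
        exact div_self h0
      · change ν s b = η s * (ν s b / η s)
        field_simp
  choose πa hπa using hex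
  have hst : IsStationary (G.transition πp πa) η := by
    refine ⟨⟨fun s => Finset.sum_nonneg fun b _ => hν s b, hν1⟩, ?_⟩
    funext s'
    rw [hη]
    simp only
    rw [hbal s']
    simp only [Matrix.vecMul, dotProduct, transition, Finset.mul_sum]
    refine Finset.sum_congr rfl fun s _ => Finset.sum_congr rfl fun a _ =>
      Finset.sum_congr rfl fun b _ => ?_
    rw [hπa s b]
    ring
  -- `stationary` is a choice among stationary vectors, pinned down by irreducibility.
  have hstat : G.stationary πp πa = η := by
    have hex : ∃ η, IsStationary (G.transition πp πa) η := ⟨η, hst⟩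
    rw [stationary, dif_pos hex]
    exact hex.choose_spec.unique (hG πp πa) (G.transition_row_sum πp πa) hst
  refine ⟨πa, ?_⟩
  simp only [meanReward, hstat]
  refine Finset.sum_congr rfl fun s _ => Finset.sum_congr rfl fun a _ =>
      Finset.sum_congr rfl fun b _ => ?_
  rw [hπa s b]
  congr 1
  ring

open Classical in
/-- If, over windows of growing length, the empirical transition frequencies are asymptotic to
their predictions under a fixed player strategy `πp`, then limits of window averages of the rewards
lie in `R(πp)`. -/
theorem mem_rewardSet_of_tendsto_window [Nonempty Ua] (hG : G.Ergodic) (πp : Strategy S Up)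
    {θ : ℕ → S} {u : ℕ → Up} {v : ℕ → Ua} {πa : ℕ → Strategy S Ua} {M N : ℕ → ℕ}
    (hMN : ∀ n, M n < N n) (hL : Tendsto (fun n => (N n : ℝ) - M n) atTop atTop)
    (hdev : ∀ s a b s', Tendsto (fun n => (∑ i ∈ Finset.Ico (M n) (N n),
      ((if θ i = s ∧ u i = a ∧ v i = b ∧ θ (i + 1) = s' then (1 : ℝ) else 0) -
        (if θ i = s then (1 : ℝ) else 0) * (πp s a * πa i s b * G.p s a b s'))) /
          ((N n : ℝ) - M n)) atTop (𝓝 0))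
    {r : Vec d} (hr : Tendsto (fun n => ((N n : ℝ) - M n)⁻¹ •
      ∑ i ∈ Finset.Ico (M n) (N n), G.κ (θ i) (u i) (v i)) atTop (𝓝 r)) :
    r ∈ G.rewardSet πp := by
  have hLpos : ∀ n, (0 : ℝ) < (N n : ℝ) - M n := fun n => by
    rw [sub_pos]; exact_mod_cast hMN n
  -- The occupation measure weighs the adversary's mixed strategies rather than the realized
  -- actions, matching the predictions in `hdev`.
  set ν : ℕ → S × Ua → ℝ := fun n z =>
    (∑ i ∈ Finset.Ico (M n) (N n), (if θ i = z.1 then (1 : ℝ) else 0) * πa i z.1 z.2) /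
      ((N n : ℝ) - M n) with hν
  set F : ℕ → S → Up → Ua → S → ℝ := fun n s a b s' =>
    (∑ i ∈ Finset.Ico (M n) (N n),
      (if θ i = s ∧ u i = a ∧ v i = b ∧ θ (i + 1) = s' then (1 : ℝ) else 0)) /
      ((N n : ℝ) - M n) with hF
  have hνnn : ∀ n z, 0 ≤ ν n z := fun n z => by
    refine div_nonneg (Finset.sum_nonneg fun i _ => mul_nonneg ?_ ((πa i z.1).2.1 z.2))
      (hLpos n).le
    split_ifs <;> norm_num
  have hνb : ∀ n s, ∑ b, ν n (s, b) =
      (∑ i ∈ Finset.Ico (M n) (N n), (if θ i = s then (1 : ℝ) else 0)) / ((N n : ℝ) - M n) := by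
    intro n s
    simp only [hν]
    rw [← Finset.sum_div, Finset.sum_comm]
    congr 1
    refine Finset.sum_congr rfl fun i _ => ?_
    have : ∑ b, πa i s b = 1 := (πa i s).2.2
    by_cases h : θ i = s <;> simp [h, this]
  have hνmem : ∀ n, ν n ∈ stdSimplex ℝ (S × Ua) := by
    intro n
    refine ⟨hνnn n, ?_⟩
    rw [Fintype.sum_prod_type]
    simp_rw [hνb]
    rw [← Finset.sum_div, Finset.sum_comm]
    have : ∑ i ∈ Finset.Ico (M n) (N n), ∑ s, (if θ i = s then (1 : ℝ) else 0)
        = (N n : ℝ) - M n := by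
      simp [Nat.cast_sub (hMN n).le]
    rw [this, div_self (hLpos n).ne']
  -- Compactness of the simplex gives a limit occupation measure; by `hdev` it also determines the
  -- limits of the transition frequencies along φ.
  obtain ⟨ν', hν'mem, φ, hφ, hlim⟩ := (isCompact_stdSimplex ℝ (S × Ua)).tendsto_subseq hνmem
  have hlim' : ∀ z, Tendsto (fun n => ν (φ n) z) atTop (𝓝 (ν' z)) := fun z =>
    (tendsto_pi_nhds.1 hlim) z
  have hFlim : ∀ s a b s', Tendsto (fun n => F (φ n) s a b s') atTop
      (𝓝 (πp s a * ν' (s, b) * G.p s a b s')) := by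
    intro s a b s'
    have h1 := ((hdev s a b s').comp hφ.tendsto_atTop).add
      (((hlim' (s, b)).const_mul (πp s a)).mul_const (G.p s a b s'))
    rw [zero_add] at h1
    refine h1.congr fun n => ?_
    simp only [Function.comp, hF, hν]
    rw [Finset.sum_sub_distrib, sub_div, mul_div_assoc', div_mul_eq_mul_div, Finset.mul_sum,
      Finset.sum_mul]
    have : ∀ i, (if θ i = s then (1 : ℝ) else 0) * (πp s a * πa i s b * G.p s a b s') =
        πp s a * ((if θ i = s then (1 : ℝ) else 0) * πa i s b) * G.p s a b s' := fun i => by ring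
    simp_rw [this]
    ring
  have hsplit : ∀ (i : ℕ) s a b s',
      (if θ i = s ∧ u i = a ∧ v i = b ∧ θ (i + 1) = s' then (1 : ℝ) else 0) =
      (if θ i = s then (1 : ℝ) else 0) * ((if u i = a then (1 : ℝ) else 0) *
        ((if v i = b then (1 : ℝ) else 0) * (if θ (i + 1) = s' then (1 : ℝ) else 0))) := by
    intro i s a b s'
    by_cases h1 : θ i = s <;> by_cases h2 : u i = a <;> by_cases h3 : v i = b <;>
      by_cases h4 : θ (i + 1) = s' <;> simp [h1, h2, h3, h4]
  have hr' : r = ∑ s, ∑ a, ∑ b, (πp s a * ν' (s, b)) • G.κ s a b := by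
    have e : ∀ n, ((N n : ℝ) - M n)⁻¹ • ∑ i ∈ Finset.Ico (M n) (N n), G.κ (θ i) (u i) (v i) =
        ∑ s, ∑ a, ∑ b, ∑ s', F n s a b s' • G.κ s a b := by
      intro n
      have e1 : ∀ s a b s', F n s a b s' • G.κ s a b = ((N n : ℝ) - M n)⁻¹ •
          ∑ i ∈ Finset.Ico (M n) (N n),
            (if θ i = s ∧ u i = a ∧ v i = b ∧ θ (i + 1) = s' then (1 : ℝ) else 0) •
              G.κ s a b := by
        intro s a b s'
        simp only [hF]
        rw [div_eq_inv_mul, mul_smul, Finset.sum_smul]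
      simp_rw [e1, ← Finset.smul_sum]
      congr 1
      have e2 : ∀ i, G.κ (θ i) (u i) (v i) = ∑ s, ∑ a, ∑ b, ∑ s',
          (if θ i = s ∧ u i = a ∧ v i = b ∧ θ (i + 1) = s' then (1 : ℝ) else 0) •
              G.κ s a b := by
        intro i
        simp_rw [hsplit, mul_smul, ← Finset.smul_sum]
        simp [ite_smul]
      simp_rw [e2]
      rw [Finset.sum_comm]
      refine Finset.sum_congr rfl fun s _ => ?_
      rw [Finset.sum_comm]
      refine Finset.sum_congr rfl fun a _ => ?_
      rw [Finset.sum_comm]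
      refine Finset.sum_congr rfl fun b _ => ?_
      rw [Finset.sum_comm]
    have h1 : Tendsto (fun n => ∑ s, ∑ a, ∑ b, ∑ s', F (φ n) s a b s' • G.κ s a b) atTop
        (𝓝 (∑ s, ∑ a, ∑ b, ∑ s', (πp s a * ν' (s, b) * G.p s a b s') • G.κ s a b)) :=
      tendsto_finsetSum _ fun s _ => tendsto_finsetSum _ fun a _ => tendsto_finsetSum _ fun b _ =>
        tendsto_finsetSum _ fun s' _ => (hFlim s a b s').smul_const _
    have h2 := hr.comp hφ.tendsto_atTop
    rw [tendsto_nhds_unique h2 (h1.congr fun n => (e (φ n)).symm)]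
    refine Finset.sum_congr rfl fun s _ => Finset.sum_congr rfl fun a _ =>
      Finset.sum_congr rfl fun b _ => ?_
    rw [← Finset.sum_smul, ← Finset.mul_sum]
    have : ∑ s', G.p s a b s' = 1 := (G.p s a b).2.2
    rw [this, mul_one]
  rw [hr']
  refine G.sum_smul_mem_rewardSet hG πp (ν := fun s b => ν' (s, b)) (fun s b => hν'mem.1 _) ?_ ?_
  · rw [← hν'mem.2, Fintype.sum_prod_type]
  · intro s'
    have e1 : ∀ n, ∑ s, ∑ a, ∑ b, F n s a b s' =
        (∑ i ∈ Finset.Ico (M n) (N n), (if θ (i + 1) = s' then (1 : ℝ) else 0)) /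
          ((N n : ℝ) - M n) := by
      intro n
      simp only [hF, ← Finset.sum_div]
      congr 1
      have e2 : ∀ i, (if θ (i + 1) = s' then (1 : ℝ) else 0) = ∑ s, ∑ a, ∑ b,
          (if θ i = s ∧ u i = a ∧ v i = b ∧ θ (i + 1) = s' then (1 : ℝ) else 0) := by
        intro i
        simp_rw [hsplit, ← Finset.mul_sum, ← Finset.sum_mul]
        simp
      simp_rw [e2]
      symm
      rw [Finset.sum_comm]
      refine Finset.sum_congr rfl fun s _ => ?_
      rw [Finset.sum_comm]
      refine Finset.sum_congr rfl fun a _ => ?_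
      rw [Finset.sum_comm]
    have h1 : Tendsto (fun n => ∑ s, ∑ a, ∑ b, F (φ n) s a b s') atTop
        (𝓝 (∑ s, ∑ a, ∑ b, πp s a * ν' (s, b) * G.p s a b s')) :=
      tendsto_finsetSum _ fun s _ => tendsto_finsetSum _ fun a _ => tendsto_finsetSum _ fun b _ =>
        hFlim s a b s'
    have h2 : Tendsto (fun n => ∑ b, ν (φ n) (s', b)) atTop (𝓝 (∑ b, ν' (s', b))) :=
      tendsto_finsetSum _ fun b _ => hlim' (s', b)
    -- Balance: entries into s' and visits to s' over a window telescope, so their counts differ by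
    -- at most 1, which the growing length kills.
    have h3 : Tendsto (fun n => ∑ s, ∑ a, ∑ b, F n s a b s' - ∑ b, ν n (s', b)) atTop (𝓝 0) := by
      have hb : Tendsto (fun n => 1 / ((N n : ℝ) - M n)) atTop (𝓝 0) := by
        exact hL.inv_tendsto_atTop.congr fun n => by simp
      refine squeeze_zero_norm (fun n => ?_) hb
      rw [e1, hνb, ← sub_div, ← Finset.sum_sub_distrib,
        Finset.sum_Ico_sub (fun i => if θ i = s' then (1 : ℝ) else 0) (hMN n).le, norm_div,
        Real.norm_of_nonneg (hLpos n).le]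
      refine div_le_div_of_nonneg_right ?_ (hLpos n).le
      split_ifs <;> norm_num
    have h4 := tendsto_nhds_unique (h3.comp hφ.tendsto_atTop) (h1.sub h2)
    exact (sub_eq_zero.1 h4.symm).symm

end Game

end Stationary

/-! ### Harmonic time, interpolation and running averages -/

section RescaledTime

theorem rescaledTime_zero : rescaledTime 0 = 0 := by simp [rescaledTime]

theorem rescaledTime_succ (n : ℕ) : rescaledTime (n + 1) = rescaledTime n + 1 / ((n : ℝ) + 1) := by
  rw [rescaledTime, Finset.sum_Icc_succ_top (by omega), rescaledTime]
  push_cast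
  rfl

theorem rescaledTime_strictMono : StrictMono rescaledTime :=
  strictMono_nat_of_lt_succ fun n => by
    rw [rescaledTime_succ]
    have : (0 : ℝ) < 1 / ((n : ℝ) + 1) := by positivity
    linarith

theorem rescaledTime_nonneg (n : ℕ) : 0 ≤ rescaledTime n := by
  rw [← rescaledTime_zero]
  exact rescaledTime_strictMono.monotone (Nat.zero_le n)

theorem rescaledTime_eq_harmonic (n : ℕ) : rescaledTime n = (harmonic n : ℝ) := by
  rw [rescaledTime, harmonic_eq_sum_Icc]
  push_cast
  simp

theorem tendsto_rescaledTime_sub_log :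
    Tendsto (fun n : ℕ => rescaledTime n - Real.log n) atTop (𝓝 Real.eulerMascheroniConstant) := by
  simp_rw [rescaledTime_eq_harmonic]
  exact Real.tendsto_harmonic_sub_log

theorem tendsto_rescaledTime_atTop : Tendsto rescaledTime atTop atTop := by
  have h1 : Tendsto (fun n : ℕ => Real.log n) atTop atTop :=
    Real.tendsto_log_atTop.comp tendsto_natCast_atTop_atTop
  have := h1.atTop_add tendsto_rescaledTime_sub_log
  refine this.congr fun n => by ring

/-- Because t(n) - log n converges, differences of rescaled times agree asymptotically with
log(N/M). -/
theorem tendsto_div_of_tendsto_rescaledTime_sub {M N : ℕ → ℕ} {h : ℝ}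
    (hM : Tendsto M atTop atTop) (hN : Tendsto N atTop atTop)
    (hMN : Tendsto (fun n => rescaledTime (N n) - rescaledTime (M n)) atTop (𝓝 h)) :
    Tendsto (fun n => (M n : ℝ) / N n) atTop (𝓝 (Real.exp (-h))) := by
  have h1 := (tendsto_rescaledTime_sub_log.comp hN).sub (tendsto_rescaledTime_sub_log.comp hM)
  have h2 := h1.sub hMN
  rw [sub_self, zero_sub] at h2
  refine ((Real.continuous_exp.tendsto _).comp h2).congr' ?_
  filter_upwards [hM.eventually_gt_atTop 0, hN.eventually_gt_atTop 0] with n hm hn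
  have hm' : (0 : ℝ) < M n := by exact_mod_cast hm
  have hn' : (0 : ℝ) < N n := by exact_mod_cast hn
  have : rescaledTime (N n) - Real.log (N n) - (rescaledTime (M n) - Real.log (M n)) -
      (rescaledTime (N n) - rescaledTime (M n)) = Real.log (M n) - Real.log (N n) := by ring
  simp only [Function.comp, this]
  rw [Real.exp_sub, Real.exp_log hm', Real.exp_log hn']

/-- The switching rule sums over [s, m) while t(m) - t(s) sums over (s, m], hence the boundary
terms. The case s = 0 relies on 1/0 = 0. -/
theorem sum_Ico_one_div {s m : ℕ} (hsm : s ≤ m) :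
    ∑ i ∈ Finset.Ico s m, 1 / (i : ℝ) =
      rescaledTime m - rescaledTime s + 1 / (s : ℝ) - 1 / (m : ℝ) := by
  induction m, hsm using Nat.le_induction with
  | base => simp
  | succ m hm ih =>
    rw [Finset.sum_Ico_succ_top hm, ih, rescaledTime_succ]
    push_cast
    ring

/-- The index of the interpolation interval that contains a time `t ≥ 0`. -/
theorem exists_mem_interval {t : ℝ} (ht : 0 ≤ t) :
    ∃ n : ℕ, rescaledTime n ≤ t ∧ t < rescaledTime (n + 1) := by
  have hne : {n : ℕ | t < rescaledTime (n + 1)}.Nonempty := by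
    obtain ⟨n, hn⟩ := (tendsto_rescaledTime_atTop.eventually_gt_atTop t).exists
    exact ⟨n, hn.trans (rescaledTime_strictMono n.lt_succ_self)⟩
  refine ⟨sInf {n : ℕ | t < rescaledTime (n + 1)}, ?_, Nat.sInf_mem hne⟩
  by_contra! h
  rcases hn : sInf {n : ℕ | t < rescaledTime (n + 1)} with _ | k
  · rw [hn, rescaledTime_zero] at h
    exact absurd ht (not_le.2 h)
  · rw [hn] at h
    have : sInf {n : ℕ | t < rescaledTime (n + 1)} ≤ k := Nat.sInf_le h
    omega

variable {d : ℕ}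

theorem interpolate_eq (x : ℕ → Vec d) {t : ℝ} {n : ℕ} (h1 : rescaledTime n ≤ t)
    (h2 : t < rescaledTime (n + 1)) :
    interpolate x t = x n + ((t - rescaledTime n) * ((n : ℝ) + 1)) • (x (n + 1) - x n) := by
  have hidx : sInf {n : ℕ | t < rescaledTime (n + 1)} = n := by
    refine le_antisymm (Nat.sInf_le h2) ?_
    by_contra! hlt
    have hmem : t < rescaledTime (sInf {n : ℕ | t < rescaledTime (n + 1)} + 1) :=
      Nat.sInf_mem (s := {n : ℕ | t < rescaledTime (n + 1)}) ⟨n, h2⟩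
    have := rescaledTime_strictMono.monotone (Nat.succ_le_of_lt hlt)
    exact absurd (hmem.trans_le this) (not_lt.2 h1)
  simp only [interpolate, hidx]
  have hd : rescaledTime (n + 1) - rescaledTime n = 1 / ((n : ℝ) + 1) := by
    rw [rescaledTime_succ]; ring
  have hc : (rescaledTime (n + 1) - t) / (rescaledTime (n + 1) - rescaledTime n) =
      1 - (t - rescaledTime n) * ((n : ℝ) + 1) := by
    rw [hd, rescaledTime_succ]
    have : (n : ℝ) + 1 ≠ 0 := by positivity
    field_simp
    ring
  have hc' : (t - rescaledTime n) / (rescaledTime (n + 1) - rescaledTime n) =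
      (t - rescaledTime n) * ((n : ℝ) + 1) := by
    rw [hd]; field_simp
  rw [hc, hc', smul_sub, sub_smul, one_smul]
  abel

theorem interpolate_rescaledTime (x : ℕ → Vec d) (n : ℕ) : interpolate x (rescaledTime n) = x n := by
  rw [interpolate_eq x le_rfl (rescaledTime_strictMono n.lt_succ_self)]
  simp

theorem norm_sub_le_of_step {x : ℕ → Vec d} {V : ℝ}
    (hV : ∀ n, ‖x (n + 1) - x n‖ ≤ V * (1 / ((n : ℝ) + 1))) {m n : ℕ} (hmn : m ≤ n) :
    ‖x n - x m‖ ≤ V * (rescaledTime n - rescaledTime m) := by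
  induction n, hmn using Nat.le_induction with
  | base => simp
  | succ n hn ih =>
    calc ‖x (n + 1) - x m‖ = ‖(x (n + 1) - x n) + (x n - x m)‖ := by congr 1; abel
      _ ≤ _ := norm_add_le _ _
      _ ≤ V * (1 / ((n : ℝ) + 1)) + V * (rescaledTime n - rescaledTime m) := add_le_add (hV n) ih
      _ = _ := by rw [rescaledTime_succ]; ring

/-- The interpolation moves at most as fast as the sequence, in rescaled time. -/
theorem norm_interpolate_sub_le {x : ℕ → Vec d} {V : ℝ}
    (hV : ∀ n, ‖x (n + 1) - x n‖ ≤ V * (1 / ((n : ℝ) + 1))) {s t : ℝ} (hs : 0 ≤ s)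
    (hst : s ≤ t) : ‖interpolate x t - interpolate x s‖ ≤ V * (t - s) := by
  obtain ⟨m, hm1, hm2⟩ := exists_mem_interval hs
  obtain ⟨n, hn1, hn2⟩ := exists_mem_interval (hs.trans hst)
  have hstep : ∀ (k : ℕ) {c : ℝ}, 0 ≤ c →
      ‖(c * ((k : ℝ) + 1)) • (x (k + 1) - x k)‖ ≤ V * c := by
    intro k c hc
    have hk : (0 : ℝ) < (k : ℝ) + 1 := by positivity
    rw [norm_smul, Real.norm_of_nonneg (by positivity)]
    calc c * ((k : ℝ) + 1) * ‖x (k + 1) - x k‖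
        ≤ c * ((k : ℝ) + 1) * (V * (1 / ((k : ℝ) + 1))) := by gcongr; exact hV k
      _ = V * c := by field_simp
  rw [interpolate_eq x hm1 hm2, interpolate_eq x hn1 hn2]
  have hmn : m ≤ n := by
    by_contra! h
    have := rescaledTime_strictMono.monotone (Nat.succ_le_of_lt h)
    exact absurd (hn2.trans_le this) (not_lt.2 (hm1.trans hst))
  rcases hmn.eq_or_lt with rfl | hlt
  · have e : x m + ((t - rescaledTime m) * ((m : ℝ) + 1)) • (x (m + 1) - x m) -
        (x m + ((s - rescaledTime m) * ((m : ℝ) + 1)) • (x (m + 1) - x m)) =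
        ((t - s) * ((m : ℝ) + 1)) • (x (m + 1) - x m) := by
      rw [add_sub_add_left_eq_sub, ← sub_smul]
      congr 1
      ring
    rw [e]
    exact hstep m (by linarith)
  -- Different cells: a partial step in the last one, whole steps in between, and the rest of the
  -- step in the first one.
  · have e : x n + ((t - rescaledTime n) * ((n : ℝ) + 1)) • (x (n + 1) - x n) -
        (x m + ((s - rescaledTime m) * ((m : ℝ) + 1)) • (x (m + 1) - x m)) =
        ((t - rescaledTime n) * ((n : ℝ) + 1)) • (x (n + 1) - x n) + (x n - x (m + 1)) +
        ((rescaledTime (m + 1) - s) * ((m : ℝ) + 1)) • (x (m + 1) - x m) := by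
      have : (rescaledTime (m + 1) - s) * ((m : ℝ) + 1) =
          1 - (s - rescaledTime m) * ((m : ℝ) + 1) := by
        rw [rescaledTime_succ]; field_simp; ring
      rw [this, sub_smul, one_smul]
      abel
    rw [e]
    have h1 := hstep n (c := t - rescaledTime n) (by linarith)
    have h2 := norm_sub_le_of_step hV (Nat.succ_le_of_lt hlt)
    have h3 := hstep m (c := rescaledTime (m + 1) - s) (by linarith)
    refine (norm_add₃_le).trans ?_
    calc _ ≤ V * (t - rescaledTime n) + V * (rescaledTime n - rescaledTime (m + 1)) +
          V * (rescaledTime (m + 1) - s) := add_le_add (add_le_add h1 h2) h3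
      _ = _ := by ring

theorem average_succ (x₀ : Vec d) (r : ℕ → Vec d) (n : ℕ) :
    average x₀ r (n + 1) =
      average x₀ r n + (1 / ((n : ℝ) + 1)) • (r n - average x₀ r n) := rfl

/-- The vector n x_n is the running sum of the rewards; the initial value carries weight 0. So
window sums can be read off the endpoints. -/
theorem natCast_smul_average_sub (x₀ : Vec d) (r : ℕ → Vec d) {m n : ℕ} (hmn : m ≤ n) :
    (n : ℝ) • average x₀ r n - (m : ℝ) • average x₀ r m = ∑ i ∈ Finset.Ico m n, r i := by
  induction n, hmn using Nat.le_induction with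
  | base => simp
  | succ n hn ih =>
    rw [Finset.sum_Ico_succ_top hn, ← ih, average_succ, smul_add, smul_smul]
    have : (((n + 1 : ℕ) : ℝ)) * (1 / ((n : ℝ) + 1)) = 1 := by
      push_cast; field_simp
    rw [this, one_smul]
    push_cast
    rw [add_smul, one_smul]
    abel

/-- The first step has weight 1 and erases x₀, which therefore need not lie in A; later steps are
convex combinations. -/
theorem average_succ_mem {x₀ : Vec d} {r : ℕ → Vec d} {A : Set (Vec d)} (hA : Convex ℝ A)
    (hr : ∀ n, r n ∈ A) (n : ℕ) : average x₀ r (n + 1) ∈ A := by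
  induction n with
  | zero =>
    have : average x₀ r (0 + 1) = r 0 := by rw [average_succ]; simp
    rw [this]; exact hr 0
  | succ n ih =>
    rw [average_succ]
    refine hA.add_smul_sub_mem ih (hr _) ⟨by positivity, ?_⟩
    rw [div_le_one (by positivity)]
    push_cast
    linarith [(Nat.cast_nonneg n : (0 : ℝ) ≤ n)]

end RescaledTime

/-! ### The target, its layers, the centres and the switching times -/

section Bounds

variable {S Up Ua : Type*} [Fintype S] {d : ℕ} {G : Game S Up Ua d}

namespace Game

theorem infDist_pos (hD : G.D.Nonempty) {x : Vec d} (hx : x ∉ closure G.D) :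
    0 < Metric.infDist x G.D := by
  rw [← Metric.infDist_closure]
  exact (isClosed_closure.notMem_iff_infDist_pos hD.closure).1 hx

theorem layer_subset (hD : G.D.Nonempty) (n : ℕ) : G.layer n ⊆ G.K \ closure G.D := by
  rintro y ⟨hy, h1, -⟩
  refine ⟨hy, fun h => ?_⟩
  rw [Metric.mem_closure_iff_infDist_zero hD] at h
  rw [h] at h1
  exact absurd h1 (not_le.2 (by positivity))

/-- Points of `K` at distance at least `1/(n+1)` from `D` lie in the first layers. -/
theorem exists_mem_layer {x : Vec d} (hx : x ∈ G.K) {n : ℕ}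
    (hn : 1 / ((n : ℝ) + 1) ≤ Metric.infDist x G.D) : ∃ k ≤ n, x ∈ G.layer k := by
  classical
  have hex : ∃ k : ℕ, 1 / ((k : ℝ) + 1) ≤ Metric.infDist x G.D := ⟨n, hn⟩
  refine ⟨Nat.find hex, Nat.find_min' hex hn, hx, Nat.find_spec hex, fun h0 => ?_⟩
  obtain ⟨k, hk⟩ := Nat.exists_eq_succ_of_ne_zero h0
  have := Nat.find_min hex (m := k) (by omega)
  rw [hk]
  push_cast
  exact (not_le.1 this).le

theorem exists_layer (hD : G.D.Nonempty) {x : Vec d} (hx : x ∈ G.K \ closure G.D) :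
    ∃ k, x ∈ G.layer k := by
  obtain ⟨n, hn⟩ := exists_nat_one_div_lt (infDist_pos hD hx.2)
  obtain ⟨k, -, hk⟩ := exists_mem_layer hx.1 hn.le
  exact ⟨k, hk⟩

theorem proj_spec (hD : G.D.Nonempty) (x : Vec d) :
    G.proj x ∈ closure G.D ∧ ∀ z ∈ closure G.D, ‖x - G.proj x‖ ≤ ‖x - z‖ := by
  have hex : ∃ y, y ∈ closure G.D ∧ ∀ z ∈ closure G.D, ‖x - y‖ ≤ ‖x - z‖ := by
    obtain ⟨y, hy, h⟩ := isClosed_closure.exists_infDist_eq_dist hD.closure x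
    refine ⟨y, hy, fun z hz => ?_⟩
    rw [← dist_eq_norm, ← dist_eq_norm, ← h]
    exact Metric.infDist_le_dist_of_mem hz
  exact Classical.epsilon_spec hex

theorem norm_sub_proj (hD : G.D.Nonempty) (x : Vec d) :
    ‖x - G.proj x‖ = Metric.infDist x G.D := by
  rw [← Metric.infDist_closure]
  refine le_antisymm ?_ ?_
  · refine (Metric.le_infDist hD.closure).2 fun z hz => ?_
    rw [dist_eq_norm]
    exact (proj_spec hD x).2 z hz
  · rw [← dist_eq_norm]
    exact Metric.infDist_le_dist_of_mem (proj_spec hD x).1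

theorem proj_eq_self (hD : G.D.Nonempty) {x : Vec d} (hx : x ∈ closure G.D) : G.proj x = x := by
  have := (proj_spec hD x).2 x hx
  rw [sub_self, norm_zero, norm_le_zero_iff, sub_eq_zero] at this
  exact this.symm

variable [Fintype Up] [Fintype Ua]

theorem norm_sub_le_vmax (hK : IsCompact G.K) {x : Vec d} (hx : x ∈ G.K) (θ : S) (a : Up)
    (b : Ua) : ‖G.κ θ a b - x‖ ≤ G.vmax := by
  refine le_csSup ?_ ⟨x, hx, θ, a, b, rfl⟩
  obtain ⟨R, hR⟩ := hK.isBounded.exists_norm_le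
  refine ⟨∑ θ, ∑ a, ∑ b, ‖G.κ θ a b‖ + R, ?_⟩
  rintro r ⟨x, hx, θ, a, b, rfl⟩
  refine (norm_sub_le _ _).trans (add_le_add ?_ (hR x hx))
  calc ‖G.κ θ a b‖ ≤ ∑ b, ‖G.κ θ a b‖ :=
        Finset.single_le_sum (f := fun b => ‖G.κ θ a b‖) (fun _ _ => norm_nonneg _)
          (Finset.mem_univ b)
    _ ≤ ∑ a, ∑ b, ‖G.κ θ a b‖ :=
        Finset.single_le_sum (f := fun a => ∑ b, ‖G.κ θ a b‖)
          (fun _ _ => Finset.sum_nonneg fun _ _ => norm_nonneg _) (Finset.mem_univ a)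
    _ ≤ _ := Finset.single_le_sum (f := fun θ => ∑ a, ∑ b, ‖G.κ θ a b‖)
          (fun _ _ => Finset.sum_nonneg fun _ _ => Finset.sum_nonneg fun _ _ => norm_nonneg _)
          (Finset.mem_univ θ)

/-- Otherwise one reward vector would equal every point of K, which contains both x and a point of
D. -/
theorem vmax_pos [Nonempty S] [Nonempty Up] [Nonempty Ua] (hK : IsCompact G.K) (hDK : G.D ⊆ G.K)
    (hD : G.D.Nonempty) {x : Vec d} (hx : x ∈ G.K \ closure G.D) : 0 < G.vmax := by
  obtain ⟨z, hz⟩ := hD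
  have hne : x ≠ z := fun h => hx.2 (h ▸ subset_closure hz)
  let θ : S := Classical.arbitrary S
  let a : Up := Classical.arbitrary Up
  let b : Ua := Classical.arbitrary Ua
  have h1 := norm_sub_le_vmax hK hx.1 θ a b
  have h2 := norm_sub_le_vmax hK (hDK hz) θ a b
  by_contra! h
  have e1 := sub_eq_zero.1 (norm_le_zero_iff.1 (h1.trans h))
  have e2 := sub_eq_zero.1 (norm_le_zero_iff.1 (h2.trans h))
  exact hne (e1.symm.trans e2)

end Game

namespace Scheme

variable [Fintype Up] [Fintype Ua] (C : Scheme G)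

theorem centres_subset (hD : G.D.Nonempty) : C.centres ⊆ G.K \ closure G.D :=
  Set.iUnion_subset fun n => (C.net_subset n).trans (Game.layer_subset hD n)

theorem T_pos [Nonempty S] [Nonempty Up] [Nonempty Ua] (hK : IsCompact G.K) (hDK : G.D ⊆ G.K)
    (hD : G.D.Nonempty) {q : Vec d} (hq : q ∈ C.centres) : 0 < C.T q := by
  have hq' := C.centres_subset hD hq
  have hv := Game.vmax_pos hK hDK hD hq'
  have hρ := C.ρ_pos q hq'
  exact lt_trans (by positivity) (C.T_bounds q hq).1

/-- A trajectory moves less than ρ/3 in rescaled time T(q), so from within ρ/2 of q it stays in B(q,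
ρ). -/
theorem vmax_mul_T_lt [Nonempty S] [Nonempty Up] [Nonempty Ua] (hK : IsCompact G.K)
    (hDK : G.D ⊆ G.K) (hD : G.D.Nonempty) {q : Vec d} (hq : q ∈ C.centres) :
    G.vmax * C.T q < C.ρ q / 3 := by
  have hv := Game.vmax_pos hK hDK hD (C.centres_subset hD hq)
  have := (C.T_bounds q hq).2
  rw [lt_div_iff₀ (by positivity)] at this
  linarith

/-- The radius at a centre is at most its distance to the target. -/
theorem ρ_le_infDist (hD : G.D.Nonempty) [Nonempty Ua] {q : Vec d} (hq : q ∈ C.centres) :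
    C.ρ q ≤ Metric.infDist q G.D := by
  obtain ⟨ε, hε, h⟩ := C.separates q (C.centres_subset hD hq)
  refine (Metric.le_infDist hD).2 fun z hz => ?_
  by_contra! hlt
  -- At a point z of D the vector `G.proj z - z` is 0, so separation would read ε ≤ 0.
  have := h z (by rw [Metric.mem_ball, dist_comm]; exact hlt) (Classical.arbitrary _)
  rw [Game.proj_eq_self hD (subset_closure hz), sub_self, inner_zero_right] at this
  linarith

theorem exists_centre {x : Vec d} {k : ℕ} (hx : x ∈ G.layer k) :
    ∃ q ∈ C.net k, x ∈ Metric.ball q (C.ρ q / 2) := by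
  simpa using C.net_covers k hx

theorem Q_spec (hD : G.D.Nonempty) {x : Vec d} (hx : x ∈ G.K \ closure G.D) :
    C.Q x ∈ C.centres ∧ x ∈ Metric.ball (C.Q x) (C.ρ (C.Q x) / 2) ∧
      ∀ q ∈ C.centres, x ∈ Metric.ball q (C.ρ q / 2) → C.index (C.Q x) ≤ C.index q := by
  obtain ⟨k, hk⟩ := Game.exists_layer hD hx
  obtain ⟨q, hq, hxq⟩ := C.exists_centre hk
  have hne : {q ∈ C.centres | x ∈ Metric.ball q (C.ρ q / 2)}.Nonempty :=
    ⟨q, Set.mem_iUnion.2 ⟨k, hq⟩, hxq⟩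
  have hQ : C.Q x = Function.argminOn C.index _ hne := by rw [Q, dif_pos hne]
  have hmem := Function.argminOn_mem C.index _ hne
  rw [← hQ] at hmem
  refine ⟨hmem.1, hmem.2, fun q hq hxq => ?_⟩
  rw [hQ]
  have hmem' : q ∈ {q ∈ C.centres | x ∈ Metric.ball q (C.ρ q / 2)} := ⟨hq, hxq⟩
  exact Function.argminOn_le C.index _ hmem'

/-- Away from the target only finitely many centres are used. -/
theorem finite_Q_image (hD : G.D.Nonempty) {c : ℝ} (hc : 0 < c) :
    (C.Q '' {x ∈ G.K | c ≤ Metric.infDist x G.D}).Finite := by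
  obtain ⟨n, hn⟩ := exists_nat_one_div_lt hc
  -- A crude bound for all indices in the first n + 1 nets. Since Q minimizes the index, it never
  -- exceeds B here, and injectivity of the index gives finiteness.
  set B : ℕ := ∑ k ∈ Finset.range (n + 1), ∑ q ∈ C.net k, C.index q with hB
  have hsub : C.Q '' {x ∈ G.K | c ≤ Metric.infDist x G.D} ⊆
      {q ∈ C.centres | C.index q ≤ B} := by
    rintro _ ⟨x, ⟨hxK, hxc⟩, rfl⟩
    have hx : x ∈ G.K \ closure G.D := ⟨hxK, fun h => by
      rw [Metric.mem_closure_iff_infDist_zero hD] at h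
      linarith⟩
    obtain ⟨k, hkn, hk⟩ := Game.exists_mem_layer hxK (hn.le.trans hxc)
    obtain ⟨q, hq, hxq⟩ := C.exists_centre hk
    obtain ⟨h1, -, h3⟩ := C.Q_spec hD hx
    refine ⟨h1, (h3 q (Set.mem_iUnion.2 ⟨k, hq⟩) hxq).trans ?_⟩
    calc C.index q ≤ ∑ q ∈ C.net k, C.index q :=
          Finset.single_le_sum (f := C.index) (fun _ _ => Nat.zero_le _) hq
      _ ≤ B := Finset.single_le_sum (f := fun k => ∑ q ∈ C.net k, C.index q)
          (fun _ _ => Nat.zero_le _) (Finset.mem_range.2 (Nat.lt_succ_of_le hkn))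
  refine Set.Finite.subset (Set.Finite.of_finite_image (f := C.index) ?_ ?_) hsub
  · exact (Set.finite_Iic B).subset (by rintro _ ⟨q, hq, rfl⟩; exact hq.2)
  · exact C.index_injOn.mono fun q hq => hq.1

section Switching

variable [Nonempty S] [Nonempty Up] [Nonempty Ua]
variable (hK : IsCompact G.K) (hDK : G.D ⊆ G.K) (hD : G.D.Nonempty)
variable {x : ℕ → Vec d} (hx : ∀ n, x n ∈ G.K)

include hK hDK hD hx in
-- The sum overshoots T(q) by at most its last term; passing from [s, m) to (s, m] costs boundary
-- terms of the same order. The estimates need s ≥ 1 for 1/s to be a genuine error.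
theorem nextSwitch_spec {s : ℕ} (hs : x s ∉ closure G.D) :
    s < C.nextSwitch x s ∧ (1 ≤ s →
      C.T (C.Q (x s)) - 1 / (s : ℝ) ≤ rescaledTime (C.nextSwitch x s) - rescaledTime s ∧
      rescaledTime (C.nextSwitch x s) - rescaledTime s ≤ C.T (C.Q (x s)) + 1 / (s : ℝ)) := by
  have hT := C.T_pos hK hDK hD (C.Q_spec hD ⟨hx s, hs⟩).1
  set A := {m : ℕ | C.T (C.Q (x s)) < ∑ i ∈ Finset.Ico (max s 1) m, 1 / (i : ℝ)} with hA
  have hns : C.nextSwitch x s = sInf A := by rw [nextSwitch, if_neg hs]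
  have hne : A.Nonempty := by
    obtain ⟨m, hm1, hm2⟩ := ((tendsto_rescaledTime_atTop.eventually_gt_atTop
      (C.T (C.Q (x s)) + rescaledTime (max s 1) + 1)).and (eventually_ge_atTop (max s 1))).exists
    refine ⟨m, ?_⟩
    rw [hA, Set.mem_ofPred_eq, sum_Ico_one_div hm2]
    have h1 : (0 : ℝ) ≤ 1 / ((max s 1 : ℕ) : ℝ) := by positivity
    have h2 : 1 / (m : ℝ) ≤ 1 := by
      rw [div_le_one (by exact_mod_cast lt_of_lt_of_le (by simp) hm2)]
      exact_mod_cast (le_max_right s 1).trans hm2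
    linarith
  have hmem : sInf A ∈ A := Nat.sInf_mem hne
  have hgt : max s 1 < sInf A := by
    by_contra! h
    have h' : C.T (C.Q (x s)) < ∑ i ∈ Finset.Ico (max s 1) (sInf A), 1 / (i : ℝ) := hmem
    rw [Finset.Ico_eq_empty_of_le h, Finset.sum_empty] at h'
    linarith
  rw [hns]
  refine ⟨(le_max_left s 1).trans_lt hgt, fun hs1 => ?_⟩
  have hmax : max s 1 = s := max_eq_left hs1
  rw [hmax] at hgt
  have hspos : (0 : ℝ) < s := by exact_mod_cast hs1
  have hle : ∀ {k : ℕ}, s ≤ k → 1 / (k : ℝ) ≤ 1 / (s : ℝ) := fun {k} hk =>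
    one_div_le_one_div_of_le hspos (by exact_mod_cast hk)
  have h1 : C.T (C.Q (x s)) < ∑ i ∈ Finset.Ico (max s 1) (sInf A), 1 / (i : ℝ) := hmem
  rw [hmax, sum_Ico_one_div hgt.le] at h1
  have hpos : (0 : ℝ) ≤ 1 / ((sInf A : ℕ) : ℝ) := by positivity
  refine ⟨by linarith, ?_⟩
  -- Minimality: one index before the switch the sum has not yet passed T(q).
  obtain ⟨k, hk⟩ : ∃ k, sInf A = k + 1 := ⟨sInf A - 1, by omega⟩
  have hsk : s ≤ k := by omega
  have hk' : k ∉ A := fun h => by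
    have := Nat.sInf_le h
    omega
  have h2 : ∑ i ∈ Finset.Ico s k, 1 / (i : ℝ) ≤ C.T (C.Q (x s)) := by
    rw [hA, Set.mem_ofPred_eq, not_lt, hmax] at hk'
    exact hk'
  have h3 := Finset.sum_Ico_succ_top hsk (fun i : ℕ => 1 / (i : ℝ))
  rw [sum_Ico_one_div (by omega)] at h3
  rw [hk]
  have h4 := hle hsk
  have h5 := hle (k := k + 1) (by omega)
  linarith

include hK hDK hD hx in
theorem lt_nextSwitch (s : ℕ) : s < C.nextSwitch x s := by
  by_cases h : x s ∈ closure G.D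
  · rw [nextSwitch, if_pos h]; exact s.lt_succ_self
  · exact (C.nextSwitch_spec hK hDK hD hx h).1

include hK hDK hD hx in
theorem switchTime_strictMono : StrictMono (C.switchTime x) :=
  strictMono_nat_of_lt_succ fun n => C.lt_nextSwitch hK hDK hD hx (C.switchTime x n)

include hK hDK hD hx in
theorem period_eq {m n : ℕ} (h1 : C.switchTime x m ≤ n) (h2 : n < C.switchTime x (m + 1)) :
    C.period x n = m := by
  have hmono := C.switchTime_strictMono hK hDK hD hx
  rw [period, Nat.findGreatest_eq_iff]
  -- Strict monotonicity gives m ≤ s_m ≤ n, so m lies within the search bound of `Nat.findGreatest`.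
  refine ⟨(hmono.id_le m).trans h1, fun _ => h1, fun k hk _ h => ?_⟩
  exact absurd (h2.trans_le (hmono.monotone (Nat.succ_le_of_lt hk))) (not_lt.2 h)

include hK hDK hD hx in
theorem playerStrategy_eq {m n : ℕ} (h1 : C.switchTime x m ≤ n) (h2 : n < C.switchTime x (m + 1))
    (hm : x (C.switchTime x m) ∉ closure G.D) :
    C.playerStrategy x n = C.strat (C.Q (x (C.switchTime x m))) := by
  rw [playerStrategy, C.period_eq hK hDK hD hx h1 h2]
  exact if_neg hm

end Switching

end Scheme

end Bounds

/-! ### Limit trajectories and the null exceptional set -/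

section Trajectories

variable {S Up Ua : Type*} [Fintype S] [Fintype Up] [Fintype Ua] {d : ℕ} {G : Game S Up Ua d}

theorem Game.vmax_nonneg [Nonempty S] [Nonempty Up] [Nonempty Ua] (hK : IsCompact G.K)
    {x : Vec d} (hx : x ∈ G.K) : 0 ≤ G.vmax :=
  (norm_nonneg _).trans (Game.norm_sub_le_vmax hK hx (Classical.arbitrary S)
    (Classical.arbitrary Up) (Classical.arbitrary Ua))

namespace Scheme

variable (C : Scheme G)

theorem path_mem (hκ : convexHull ℝ {r | ∃ θ a b, r = G.κ θ a b} ⊆ G.K) {Ω : Type*} {x₀ : Vec d}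
    (hx₀ : x₀ ∈ G.K) (θ : ℕ → Ω → S) (up : ℕ → Ω → Up) (ua : ℕ → Ω → Ua) (ω : Ω) (n : ℕ) :
    C.path x₀ θ up ua ω n ∈ G.K := by
  cases n with
  | zero => exact hx₀
  | succ n =>
    refine hκ (average_succ_mem (convex_convexHull ℝ _) (fun i => subset_convexHull ℝ _ ?_) n)
    exact ⟨_, _, _, rfl⟩

theorem norm_path_succ_sub_le (hK : IsCompact G.K)
    (hκ : convexHull ℝ {r | ∃ θ a b, r = G.κ θ a b} ⊆ G.K) {Ω : Type*} {x₀ : Vec d}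
    (hx₀ : x₀ ∈ G.K) (θ : ℕ → Ω → S) (up : ℕ → Ω → Up) (ua : ℕ → Ω → Ua) (ω : Ω) (n : ℕ) :
    ‖C.path x₀ θ up ua ω (n + 1) - C.path x₀ θ up ua ω n‖ ≤ G.vmax * (1 / ((n : ℝ) + 1)) := by
  have h := Game.norm_sub_le_vmax hK (C.path_mem hκ hx₀ θ up ua ω n) (θ n ω) (up n ω) (ua n ω)
  have e : C.path x₀ θ up ua ω (n + 1) - C.path x₀ θ up ua ω n =
      (1 / ((n : ℝ) + 1)) • (G.κ (θ n ω) (up n ω) (ua n ω) - C.path x₀ θ up ua ω n) := by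
    rw [path, average_succ, add_sub_cancel_left]
  rw [e, norm_smul, Real.norm_of_nonneg (by positivity), mul_comm]
  gcongr

/-- The rescaled length of the `m`-th holding period. -/
def holdingLength (x : ℕ → Vec d) (m : ℕ) : ℝ :=
  rescaledTime (C.switchTime x (m + 1)) - rescaledTime (C.switchTime x m)

theorem trajectory_eq (x : ℕ → Vec d) (m : ℕ) (t : ℝ) :
    C.trajectory x m t =
      interpolate x (rescaledTime (C.switchTime x m) + min t (C.holdingLength x m)) := by
  rw [trajectory]
  split_ifs with h
  · rw [holdingLength, min_eq_left h]
  · rw [holdingLength, min_eq_right (not_le.1 h).le, add_sub_cancel]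

theorem trajectory_of_le {x : ℕ → Vec d} {m : ℕ} {t : ℝ} (h : C.holdingLength x m ≤ t) :
    C.trajectory x m t = x (C.switchTime x (m + 1)) := by
  rw [trajectory_eq, min_eq_right h, holdingLength, add_sub_cancel, interpolate_rescaledTime]

variable [Nonempty S] [Nonempty Up] [Nonempty Ua]
variable (hK : IsCompact G.K) (hDK : G.D ⊆ G.K) (hD : G.D.Nonempty)
variable {x : ℕ → Vec d} (hx : ∀ n, x n ∈ G.K)
variable (hV : ∀ n, ‖x (n + 1) - x n‖ ≤ G.vmax * (1 / ((n : ℝ) + 1)))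

include hK hDK hD hx in
theorem holdingLength_pos (m : ℕ) : 0 < C.holdingLength x m :=
  sub_pos.2 (rescaledTime_strictMono (C.switchTime_strictMono hK hDK hD hx m.lt_succ_self))

include hK hDK hD hx in
theorem trajectory_zero (m : ℕ) : C.trajectory x m 0 = x (C.switchTime x m) := by
  rw [trajectory_eq, min_eq_left (C.holdingLength_pos hK hDK hD hx m).le, add_zero,
    interpolate_rescaledTime]

include hK hDK hD hx hV in
theorem norm_trajectory_sub_le (m : ℕ) {s t : ℝ} (hs : 0 ≤ s) (hst : s ≤ t) :
    ‖C.trajectory x m t - C.trajectory x m s‖ ≤ G.vmax * (t - s) := by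
  have hl := C.holdingLength_pos hK hDK hD hx m
  rw [trajectory_eq, trajectory_eq]
  have h0 := rescaledTime_nonneg (C.switchTime x m)
  refine (norm_interpolate_sub_le hV (add_nonneg h0 (le_min hs hl.le)) (by gcongr)).trans ?_
  refine mul_le_mul_of_nonneg_left ?_ (Game.vmax_nonneg hK (hx 0))
  rcases le_total s (C.holdingLength x m) with h | h
  · rw [min_eq_left h]
    linarith [min_le_left t (C.holdingLength x m)]
  · rw [min_eq_right h, min_eq_right (h.trans hst)]
    linarith

include hK hDK hD hx hV in
/-- A trajectory is close to the values of the sequence at suitable times of the holding period. -/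
theorem exists_index_near_trajectory (m : ℕ) {t : ℝ} (ht : 0 ≤ t) :
    ∃ N : ℕ, C.switchTime x m ≤ N ∧ N ≤ C.switchTime x (m + 1) ∧
      |rescaledTime N - rescaledTime (C.switchTime x m) - min t (C.holdingLength x m)| ≤
        1 / ((C.switchTime x m : ℝ) + 1) ∧
      ‖C.trajectory x m t - x N‖ ≤ G.vmax * (1 / ((C.switchTime x m : ℝ) + 1)) := by
  have hl := C.holdingLength_pos hK hDK hD hx m
  have h0 := rescaledTime_nonneg (C.switchTime x m)
  have hmin : 0 ≤ min t (C.holdingLength x m) := le_min ht hl.le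
  obtain ⟨N, hN1, hN2⟩ := exists_mem_interval (add_nonneg h0 hmin)
  have hsN : C.switchTime x m ≤ N := by
    have : rescaledTime (C.switchTime x m) < rescaledTime (N + 1) := by linarith
    exact Nat.lt_succ_iff.1 (rescaledTime_strictMono.lt_iff_lt.1 this)
  have hNs : N ≤ C.switchTime x (m + 1) := by
    refine rescaledTime_strictMono.le_iff_le.1 (hN1.trans ?_)
    have := min_le_right t (C.holdingLength x m)
    rw [holdingLength] at this ⊢
    linarith
  have hN3 : 1 / ((N : ℝ) + 1) ≤ 1 / ((C.switchTime x m : ℝ) + 1) := by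
    have : (C.switchTime x m : ℝ) ≤ N := by exact_mod_cast hsN
    gcongr
  rw [rescaledTime_succ] at hN2
  refine ⟨N, hsN, hNs, ?_, ?_⟩
  · rw [abs_le]
    constructor <;> linarith [(by positivity : (0 : ℝ) ≤ 1 / ((C.switchTime x m : ℝ) + 1))]
  · have := norm_interpolate_sub_le hV (rescaledTime_nonneg N) hN1
    rw [interpolate_rescaledTime, ← trajectory_eq] at this
    refine this.trans (mul_le_mul_of_nonneg_left ?_ (Game.vmax_nonneg hK (hx 0)))
    linarith

include hK hDK hD hx in
theorem tendsto_switchTime {m : ℕ → ℕ} (hm : StrictMono m) :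
    Tendsto (fun n => C.switchTime x (m n)) atTop atTop :=
  ((C.switchTime_strictMono hK hDK hD hx).comp hm).tendsto_atTop

include hK hDK hD hx in
theorem abs_holdingLength_sub_le {m : ℕ} (hm : x (C.switchTime x m) ∉ closure G.D)
    (h1 : 1 ≤ C.switchTime x m) :
    |C.holdingLength x m - C.T (C.Q (x (C.switchTime x m)))| ≤ 1 / (C.switchTime x m : ℝ) := by
  obtain ⟨h2, h3⟩ := (C.nextSwitch_spec hK hDK hD hx hm).2 h1
  have e : C.holdingLength x m = rescaledTime (C.nextSwitch x (C.switchTime x m)) -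
      rescaledTime (C.switchTime x m) := rfl
  rw [e, abs_le]
  constructor <;> linarith

include hK hDK hD hx in
theorem tendsto_holdingLength {m : ℕ → ℕ} (hm : StrictMono m) {q : Vec d}
    (hq : ∀ n, x (C.switchTime x (m n)) ∈ G.K \ closure G.D ∧ C.Q (x (C.switchTime x (m n))) = q) :
    Tendsto (fun n => C.holdingLength x (m n)) atTop (𝓝 (C.T q)) := by
  have hs := C.tendsto_switchTime hK hDK hD hx hm
  rw [tendsto_iff_norm_sub_tendsto_zero]
  have h0 : Tendsto (fun n => 1 / (C.switchTime x (m n) : ℝ)) atTop (𝓝 0) :=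
    tendsto_one_div_atTop_nhds_zero_nat.comp hs
  refine squeeze_zero' (Eventually.of_forall fun n => norm_nonneg _) ?_ h0
  filter_upwards [hs.eventually_ge_atTop 1] with n hn
  have := C.abs_holdingLength_sub_le hK hDK hD hx (hq n).1.2 hn
  rwa [(hq n).2] at this

open Classical in
include hK hDK hD hx hV in
/-- On the event that the law of large numbers holds, the limit trajectories have all their dyadic
rewards in `R(π^p_q)`. -/
theorem dyadicReward_mem_rewardSet (hG : G.Ergodic) {x₀ : Vec d}
    {θ : ℕ → S} {u : ℕ → Up} {v : ℕ → Ua} {πa : ℕ → Strategy S Ua}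
    (hxavg : x = average x₀ fun n => G.κ (θ n) (u n) (v n))
    (hlaw : ∀ s a b s', Tendsto (fun n : ℕ => (∑ i ∈ Finset.range n,
      ((if θ i = s ∧ u i = a ∧ v i = b ∧ θ (i + 1) = s' then (1 : ℝ) else 0) -
        (if θ i = s then (1 : ℝ) else 0) * (C.playerStrategy x i s a * πa i s b * G.p s a b s'))) /
          (n : ℝ)) atTop (𝓝 0))
    {q : Vec d} (hqC : q ∈ C.centres) {j k : ℕ} (hj : j < 2 ^ k) {m : ℕ → ℕ} (hm : StrictMono m)
    (hq : ∀ n, x (C.switchTime x (m n)) ∈ G.K \ closure G.D ∧ C.Q (x (C.switchTime x (m n))) = q)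
    {y : ℝ → Vec d} (hy : ∀ t, 0 ≤ t → Tendsto (fun n => C.trajectory x (m n) t) atTop (𝓝 (y t))) :
    dyadicReward y (C.T q) j k ∈ G.rewardSet (C.strat q) := by
  have hT := C.T_pos hK hDK hD hqC
  set h : ℝ := C.T q / 2 ^ k with hh
  have hh0 : 0 < h := by positivity
  have ht1 : 0 ≤ (j : ℝ) * h := by positivity
  have ht2 : 0 ≤ ((j : ℝ) + 1) * h := by positivity
  have ht2T : ((j : ℝ) + 1) * h ≤ C.T q := by
    have : (j : ℝ) + 1 ≤ 2 ^ k := by exact_mod_cast hj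
    calc ((j : ℝ) + 1) * h ≤ 2 ^ k * h := by gcongr
      _ = C.T q := by rw [hh]; field_simp
  have hs := C.tendsto_switchTime hK hDK hD hx hm
  have hlen := C.tendsto_holdingLength hK hDK hD hx hm hq
  have hsmall : Tendsto (fun n => 1 / ((C.switchTime x (m n) : ℝ) + 1)) atTop (𝓝 0) :=
    tendsto_one_div_add_atTop_nhds_zero_nat.comp hs
  have hsmall' : Tendsto (fun n => G.vmax * (1 / ((C.switchTime x (m n) : ℝ) + 1))) atTop (𝓝 0) := by
    simpa using hsmall.const_mul G.vmax
  -- Every time t of the limit trajectory is realized by genuine indices inside the holding periods,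
  -- which turns dyadic intervals into index windows.
  have hindex : ∀ t, 0 ≤ t → t ≤ C.T q → ∃ N : ℕ → ℕ,
      (∀ n, C.switchTime x (m n) ≤ N n ∧ N n ≤ C.switchTime x (m n + 1)) ∧
      Tendsto N atTop atTop ∧
      Tendsto (fun n => rescaledTime (N n) - rescaledTime (C.switchTime x (m n))) atTop (𝓝 t) ∧
      Tendsto (fun n => x (N n)) atTop (𝓝 (y t)) := by
    intro t ht htT
    choose N h1 h2 h3 h4 using fun n => C.exists_index_near_trajectory hK hDK hD hx hV (m n) ht
    refine ⟨N, fun n => ⟨h1 n, h2 n⟩, tendsto_atTop_mono h1 hs, ?_, ?_⟩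
    · have h5 := squeeze_zero_norm (fun n => (Real.norm_eq_abs _).trans_le (h3 n)) hsmall
      have h6 : Tendsto (fun n => min t (C.holdingLength x (m n))) atTop (𝓝 t) := by
        have := (tendsto_const_nhds (x := t)).min hlen
        rwa [min_eq_left htT] at this
      have := h5.add h6
      rw [zero_add] at this
      exact this.congr fun n => by ring
    · have := (hy t ht).sub (squeeze_zero_norm h4 hsmall')
      rw [sub_zero] at this
      exact this.congr fun n => by abel
  obtain ⟨M, hM1, hM2, hM3, hM4⟩ := hindex _ ht1 (le_trans (by gcongr; linarith) ht2T)
  obtain ⟨N, hN1, hN2, hN3, hN4⟩ := hindex _ ht2 ht2T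
  have hdiff : Tendsto (fun n => rescaledTime (N n) - rescaledTime (M n)) atTop (𝓝 h) := by
    have := hN3.sub hM3
    have e : ((j : ℝ) + 1) * h - j * h = h := by ring
    rw [e] at this
    exact this.congr fun n => by ring
  have hratio := tendsto_div_of_tendsto_rescaledTime_sub hM2 hN2 hdiff
  have hexp : Real.exp (-h) < 1 := by rw [Real.exp_lt_one_iff]; linarith
  have hexp' : 1 - Real.exp (-h) ≠ 0 := by linarith
  have hratio' : Tendsto (fun n => 1 - (M n : ℝ) / N n) atTop (𝓝 (1 - Real.exp (-h))) :=
    hratio.const_sub 1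
  -- The window lemma wants M < N for every n, so the sequences are shifted by n₀.
  obtain ⟨n₀, hn₀⟩ := eventually_atTop.1 (hdiff.eventually (lt_mem_nhds hh0))
  have hMN : ∀ n, M (n + n₀) < N (n + n₀) := fun n => by
    have := hn₀ (n + n₀) (by omega)
    exact rescaledTime_strictMono.lt_iff_lt.1 (by linarith)
  have hev : ∀ᶠ n in atTop, M n < N n := by
    filter_upwards [eventually_ge_atTop n₀] with n hn
    have := hMN (n - n₀)
    rwa [Nat.sub_add_cancel hn] at this
  have hlenMN : ∀ {n}, M n < N n → (N n : ℝ) - M n = N n * (1 - (M n : ℝ) / N n) := fun {n} hn => by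
    have : (N n : ℝ) ≠ 0 := by
      have : 0 < N n := by omega
      positivity
    field_simp
  refine G.mem_rewardSet_of_tendsto_window hG (C.strat q) (θ := θ) (u := u) (v := v) (πa := πa)
    (M := fun n => M (n + n₀)) (N := fun n => N (n + n₀)) hMN ?_ ?_ ?_
  · have h1 : Tendsto (fun n => (N n : ℝ) * (1 - (M n : ℝ) / N n)) atTop atTop :=
      (tendsto_natCast_atTop_atTop.comp hN2).atTop_mul_pos (by linarith) hratio'
    exact (tendsto_add_atTop_iff_nat n₀).2 (h1.congr' (hev.mono fun n hn => (hlenMN hn).symm))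
  · intro s a b s'
    have hl := hlaw s a b s'
    set f : ℕ → ℝ := fun i =>
      (if θ i = s ∧ u i = a ∧ v i = b ∧ θ (i + 1) = s' then (1 : ℝ) else 0) -
        (if θ i = s then (1 : ℝ) else 0) *
          (C.playerStrategy x i s a * πa i s b * G.p s a b s') with hf
    -- With S the partial sums of f, the window mean is (S_N/N - (S_M/M)(M/N)) / (1 - M/N); the
    -- denominator stays away from 0.
    have h1 := ((hl.comp hN2).sub ((hl.comp hM2).mul hratio)).div hratio' hexp'
    rw [zero_mul, sub_zero, zero_div] at h1
    refine (tendsto_add_atTop_iff_nat (f := fun n => (∑ i ∈ Finset.Ico (M n) (N n),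
      ((if θ i = s ∧ u i = a ∧ v i = b ∧ θ (i + 1) = s' then (1 : ℝ) else 0) -
        (if θ i = s then (1 : ℝ) else 0) * (C.strat q s a * πa i s b * G.p s a b s'))) /
          ((N n : ℝ) - M n)) n₀).2 (h1.congr' ?_)
    filter_upwards [hev, hM2.eventually_gt_atTop 0] with n hn hMpos
    -- The window lies within a single holding period, where the player's strategy is constantly
    -- π^p_q.
    have e : ∑ i ∈ Finset.Ico (M n) (N n),
        ((if θ i = s ∧ u i = a ∧ v i = b ∧ θ (i + 1) = s' then (1 : ℝ) else 0) -
          (if θ i = s then (1 : ℝ) else 0) * (C.strat q s a * πa i s b * G.p s a b s')) =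
        ∑ i ∈ Finset.Ico (M n) (N n), f i := by
      refine Finset.sum_congr rfl fun i hi => ?_
      rw [Finset.mem_Ico] at hi
      rw [hf]
      simp only
      rw [C.playerStrategy_eq hK hDK hD hx ((hM1 n).1.trans hi.1) (hi.2.trans_le (hN1 n).2)
        (hq n).1.2, (hq n).2]
    rw [e, Finset.sum_Ico_eq_sub _ hn.le, hlenMN hn]
    have hN0 : (N n : ℝ) ≠ 0 := by
      have : 0 < N n := by omega
      positivity
    have hM0 : (M n : ℝ) ≠ 0 := by positivity
    simp only [Function.comp, Pi.div_apply]
    rw [← div_div]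
    congr 1
    field_simp
  -- The window mean of the rewards is (N x_N - M x_M)/(N - M), whose limit is the dyadic reward.
  · have h1 := (hratio'.inv₀ hexp').smul (hN4.sub (hratio.smul hM4))
    refine (tendsto_add_atTop_iff_nat (f := fun n => ((N n : ℝ) - M n)⁻¹ •
      ∑ i ∈ Finset.Ico (M n) (N n), G.κ (θ i) (u i) (v i)) n₀).2 (h1.congr' ?_)
    filter_upwards [hev] with n hn
    have hN0 : (N n : ℝ) ≠ 0 := by
      have : 0 < N n := by omega
      positivity
    rw [← natCast_smul_average_sub x₀ (fun i => G.κ (θ i) (u i) (v i)) hn.le, ← hxavg, hlenMN hn,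
      mul_inv, mul_comm, mul_smul, smul_sub ((N n : ℝ)⁻¹), smul_smul, smul_smul,
      inv_mul_cancel₀ hN0, one_smul, div_eq_inv_mul]

open Classical in
include hK hDK hD in
/-- Almost surely, the path of averages is not exceptional. -/
theorem ae_notMem_exceptional
    (hκ : convexHull ℝ {r | ∃ θ a b, r = G.κ θ a b} ⊆ G.K) (hG : G.Ergodic) {Ω : Type*} [mΩ : MeasurableSpace Ω]
    {μ : Measure Ω} [IsProbabilityMeasure μ] {ℱ : Filtration ℕ mΩ}
    {x₀ : Vec d} {θ : ℕ → Ω → S} {up : ℕ → Ω → Up} {ua : ℕ → Ω → Ua}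
    {πa : ℕ → Ω → Strategy S Ua} (hx₀ : x₀ ∈ G.K) (hplay : C.IsPlay μ ℱ x₀ θ up ua πa) :
    ∀ᵐ ω ∂μ, C.path x₀ θ up ua ω ∉ C.exceptional := by
  have hlaw : ∀ s a b s', ∀ᵐ ω ∂μ, Tendsto (fun n : ℕ => (∑ i ∈ Finset.range n,
      ((if θ i ω = s ∧ up i ω = a ∧ ua i ω = b ∧ θ (i + 1) ω = s' then (1 : ℝ) else 0) -
        (if θ i ω = s then (1 : ℝ) else 0) *
          (C.playerStrategy (C.path x₀ θ up ua ω) i s a * πa i ω s b * G.p s a b s'))) /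
          (n : ℝ)) atTop (𝓝 0) := by
    intro s a b s'
    have hA : ∀ n, MeasurableSet[ℱ (n + 1)]
        ({ω | θ n ω = s} ∩ {ω | up n ω = a ∧ ua n ω = b ∧ θ (n + 1) ω = s'}) := fun n =>
      (ℱ.mono n.le_succ _ (hplay.state_meas n s)).inter ((hplay.player_meas n a).inter
        ((hplay.adversary_meas n b).inter (hplay.state_meas (n + 1) s')))
    have hcond : ∀ n, μ[({ω | θ n ω = s} ∩ {ω | up n ω = a ∧ ua n ω = b ∧
        θ (n + 1) ω = s'}).indicator (fun _ => (1 : ℝ)) | ℱ n] =ᵐ[μ] fun ω =>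
        (if θ n ω = s then (1 : ℝ) else 0) *
          (C.playerStrategy (C.path x₀ θ up ua ω) n s a * πa n ω s b * G.p s a b s') := by
      intro n
      have hB : MeasurableSet {ω | up n ω = a ∧ ua n ω = b ∧ θ (n + 1) ω = s'} :=
        ℱ.le (n + 1) _ ((hplay.player_meas n a).inter
          ((hplay.adversary_meas n b).inter (hplay.state_meas (n + 1) s')))
      -- The event θ n = s is known at time n, so its indicator factors out of the conditional
      -- expectation.
      rw [← Set.indicator_indicator]
      filter_upwards [condExp_indicator ((integrable_const (1 : ℝ)).indicator hB)
        (hplay.state_meas n s), hplay.step n a b s'] with ω h1 h2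
      rw [h1]
      by_cases hs : θ n ω = s
      · rw [Set.indicator_of_mem (by exact hs), h2, if_pos hs, one_mul, hs]
      · rw [Set.indicator_of_notMem (by exact hs), if_neg hs, zero_mul]
    filter_upwards [ae_tendsto_indicator_sub_condExp hA hcond] with ω hω
    refine hω.congr fun n => ?_
    simp only [Set.indicator_apply, Set.mem_inter_iff, Set.mem_ofPred_eq]
  have hall : ∀ᵐ ω ∂μ, ∀ s a b s', Tendsto (fun n : ℕ => (∑ i ∈ Finset.range n,
      ((if θ i ω = s ∧ up i ω = a ∧ ua i ω = b ∧ θ (i + 1) ω = s' then (1 : ℝ) else 0) -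
        (if θ i ω = s then (1 : ℝ) else 0) *
          (C.playerStrategy (C.path x₀ θ up ua ω) i s a * πa i ω s b * G.p s a b s'))) /
          (n : ℝ)) atTop (𝓝 0) :=
    ae_all_iff.2 fun s => ae_all_iff.2 fun a => ae_all_iff.2 fun b => ae_all_iff.2 fun s' =>
      hlaw s a b s'
  filter_upwards [hall] with ω hω hex
  simp only [exceptional, Set.mem_iUnion, Finset.mem_range] at hex
  obtain ⟨q, hqC, k, j, hj, m, hm, hq, y, hy, hnot⟩ := hex
  refine hnot (subset_closure (C.dyadicReward_mem_rewardSet hK hDK hD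
    (C.path_mem hκ hx₀ θ up ua ω) (C.norm_path_succ_sub_le hK hκ hx₀ θ up ua ω) hG
    (θ := fun n => θ n ω) (u := fun n => up n ω) (v := fun n => ua n ω) (πa := fun n => πa n ω)
    rfl hω hqC hj hm hq fun t ht => (hy t).tendsto_at ⟨ht, le_rfl⟩))

end Scheme

end Trajectories

/-! ### Arzelà–Ascoli for frozen trajectories -/

section Compactness

variable {d : ℕ}

/-- A sequence of uniformly Lipschitz functions on `[0, ∞)` that are frozen after a common time and
start in a bounded set has a subsequence that converges uniformly on compact sets. -/
theorem exists_subseq_tendstoUniformlyOn {f : ℕ → ℝ → Vec d} {V B R : ℝ} (hV : 0 ≤ V) (hB : 0 ≤ B)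
    (hlip : ∀ n s t, 0 ≤ s → s ≤ t → ‖f n t - f n s‖ ≤ V * (t - s)) (hR : ∀ n, ‖f n 0‖ ≤ R)
    (hfrozen : ∀ n t, B ≤ t → f n t = f n B) :
    ∃ φ : ℕ → ℕ, StrictMono φ ∧ ∃ y : ℝ → Vec d,
      ∀ b : ℝ, TendstoUniformlyOn (fun n => f (φ n)) y atTop (Set.Icc 0 b) := by
  have hdist : ∀ n (s t : Set.Icc 0 B), dist (f n s) (f n t) ≤ V * dist s t := by
    intro n s t
    rcases le_total (s : ℝ) t with h | h
    · rw [dist_comm, dist_comm s, dist_eq_norm, Subtype.dist_eq, Real.dist_eq,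
        abs_of_nonneg (sub_nonneg.2 h)]
      exact hlip n s t s.2.1 h
    · rw [dist_eq_norm, Subtype.dist_eq, Real.dist_eq, abs_of_nonneg (sub_nonneg.2 h)]
      exact hlip n t s t.2.1 h
  have hcont : ∀ n, Continuous fun t : Set.Icc 0 B => f n t := fun n =>
    (LipschitzWith.of_dist_le_mul (K := ⟨V, hV⟩) (hdist n)).continuous
  let F : ℕ → BoundedContinuousFunction (Set.Icc 0 B) (Vec d) := fun n =>
    BoundedContinuousFunction.mkOfCompact ⟨_, hcont n⟩
  have hcompact : IsCompact (closure (Set.range F)) := by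
    refine BoundedContinuousFunction.arzela_ascoli (Metric.closedBall 0 (R + V * B))
      (isCompact_closedBall _ _) _ ?_ ?_
    · rintro _ t ⟨n, rfl⟩
      rw [mem_closedBall_zero_iff]
      change ‖f n t‖ ≤ _
      have h1 := hlip n 0 t le_rfl t.2.1
      have h2 : V * ((t : ℝ) - 0) ≤ V * B := by
        rw [sub_zero]; exact mul_le_mul_of_nonneg_left t.2.2 hV
      calc ‖f n t‖ = ‖f n 0 + (f n t - f n 0)‖ := by congr 1; abel
        _ ≤ _ := norm_add_le _ _
        _ ≤ R + V * B := add_le_add (hR n) (h1.trans h2)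
    · refine Metric.equicontinuous_of_continuity_modulus (fun r => V * r) ?_ _ ?_
      · simpa using (tendsto_id (α := ℝ) (x := 𝓝 0)).const_mul V
      · rintro s t ⟨_, n, rfl⟩
        exact hdist n s t
  obtain ⟨g, -, φ, hφ, hg⟩ := hcompact.tendsto_subseq fun n => subset_closure ⟨n, rfl⟩
  -- The limit on [0, B] is extended as a constant, which is right because all the functions are
  -- frozen after B.
  refine ⟨φ, hφ, fun t => g (Set.projIcc 0 B hB t), fun b => ?_⟩
  have h1 := (BoundedContinuousFunction.tendsto_iff_tendstoUniformly.1 hg).comp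
    (Set.projIcc 0 B hB)
  refine h1.tendstoUniformlyOn.congr (Eventually.of_forall fun n t ht => ?_)
  change f (φ n) (Set.projIcc 0 B hB t) = f (φ n) t
  rcases le_total t B with h | h
  · rw [Set.projIcc_of_mem hB ⟨ht.1, h⟩]
  · rw [Set.projIcc_of_right_le hB h, hfrozen _ _ h]

end Compactness

/-! ### Decrease of the distance along separated trajectories -/

section Descent

variable {S Up Ua : Type*} [Fintype S] {d : ℕ} {G : Game S Up Ua d}

/-- One step of size `1 - e^{-h}` towards a reward separated from `z` by the target decreases the
squared distance to the target. -/
theorem Game.infDist_sq_step_le (hD : G.D.Nonempty) {z z' r : Vec d} {ε h V : ℝ} (hε : 0 ≤ ε)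
    (hh : 0 < h) (hr : r = (1 - Real.exp (-h))⁻¹ • (z' - Real.exp (-h) • z))
    (hsep : ε ≤ inner ℝ (r - G.proj z) (G.proj z - z)) (hz : ‖z' - z‖ ≤ V * h) :
    Metric.infDist z' G.D ^ 2 ≤
      Metric.infDist z G.D ^ 2 - (2 * ε * (h - h ^ 2) - V ^ 2 * h ^ 2) := by
  set α : ℝ := 1 - Real.exp (-h) with hα
  -- This yields 1 - e^{-h} ≥ h/(1+h) ≥ h - h².
  have hexp : Real.exp (-h) * (1 + h) ≤ 1 := by
    have h1 : h + 1 ≤ Real.exp h := Real.add_one_le_exp h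
    calc Real.exp (-h) * (1 + h) ≤ Real.exp (-h) * Real.exp h := by gcongr; linarith
      _ = 1 := by rw [← Real.exp_add]; simp
  have hα1 : h - h ^ 2 ≤ α := by
    nlinarith [Real.exp_pos (-h), mul_nonneg hh.le (sq_nonneg h)]
  have hα0 : 0 < α := by
    have : Real.exp (-h) < 1 := by rw [Real.exp_lt_one_iff]; linarith
    linarith
  have hzz : z' - z = α • (r - z) := by
    rw [hr, smul_sub, smul_smul, mul_inv_cancel₀ hα0.ne', one_smul, hα, sub_smul, one_smul]
    abel
  have hle : Metric.infDist z' G.D ≤ ‖z' - G.proj z‖ := by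
    rw [← Metric.infDist_closure, ← dist_eq_norm]
    exact Metric.infDist_le_dist_of_mem (G.proj_spec hD z).1
  -- Splitting r - z at the projection of z gives the separated term and a square of favourable
  -- sign, which is dropped. The old projection serves as competitor for the distance of z'.
  have hinner : inner ℝ (z - G.proj z) (z' - z) ≤ -(α * ε) := by
    have e1 : r - z = (r - G.proj z) + (G.proj z - z) := by abel
    have e2 : z - G.proj z = -(G.proj z - z) := by abel
    rw [hzz, inner_smul_right, e1, inner_add_right, e2, inner_neg_left, inner_neg_left,
      real_inner_comm, real_inner_self_eq_norm_sq]
    have : 0 ≤ ‖G.proj z - z‖ ^ 2 := by positivity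
    nlinarith
  have e : z' - G.proj z = (z - G.proj z) + (z' - z) := by abel
  calc Metric.infDist z' G.D ^ 2 ≤ ‖z' - G.proj z‖ ^ 2 := by
        gcongr
        exact Metric.infDist_nonneg
    _ = ‖z - G.proj z‖ ^ 2 + 2 * inner ℝ (z - G.proj z) (z' - z) + ‖z' - z‖ ^ 2 := by
        rw [e, norm_add_sq_real]
    _ ≤ Metric.infDist z G.D ^ 2 + 2 * (-(α * ε)) + (V * h) ^ 2 := by
        rw [Game.norm_sub_proj hD]
        gcongr
    _ ≤ _ := by nlinarith

/-- A trajectory whose dyadic rewards are all separated by the target comes closer to the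
target. -/
theorem infDist_sq_le_of_dyadicReward (hD : G.D.Nonempty) {y : ℝ → Vec d} {V T ε ρ : ℝ}
    {q : Vec d} {A : Set (Vec d)} (hT : 0 < T) (hε : 0 < ε) (hV : 0 ≤ V)
    (hlip : ∀ s t, 0 ≤ s → s ≤ t → ‖y t - y s‖ ≤ V * (t - s))
    (hy0 : ‖y 0 - q‖ ≤ ρ / 2) (hVT : V * T < ρ / 3)
    (hsep : ∀ z ∈ Metric.ball q ρ, ∀ r ∈ A, ε ≤ inner ℝ (r - G.proj z) (G.proj z - z))
    (hdy : ∀ k j, j < 2 ^ k → Scheme.dyadicReward y T j k ∈ A) :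
    Metric.infDist (y T) G.D ^ 2 ≤ Metric.infDist (y 0) G.D ^ 2 - ε * T := by
  -- Steps so short that the quadratic error h²(2ε + V²) uses up at most half of the gain 2εh.
  obtain ⟨k, hk⟩ : ∃ k : ℕ, T / 2 ^ k * (2 * ε + V ^ 2) ≤ ε := by
    have h1 : Tendsto (fun k : ℕ => T / 2 ^ k * (2 * ε + V ^ 2)) atTop (𝓝 0) := by
      have h2 : Tendsto (fun k : ℕ => T * (1 / 2) ^ k * (2 * ε + V ^ 2)) atTop
          (𝓝 (T * 0 * (2 * ε + V ^ 2))) :=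
        ((tendsto_pow_atTop_nhds_zero_of_lt_one (by norm_num) (by norm_num)).const_mul T).mul_const _
      rw [mul_zero, zero_mul] at h2
      refine h2.congr fun k => ?_
      rw [one_div, inv_pow, div_eq_mul_inv]
    exact (h1.eventually (ge_mem_nhds hε)).exists
  set h : ℝ := T / 2 ^ k with hh
  have hh0 : 0 < h := by positivity
  have hkT : (2 : ℝ) ^ k * h = T := by rw [hh]; field_simp
  -- Since 1/2 + 1/3 < 1, the trajectory never leaves the ball where separation holds.
  have hpos : ∀ j : ℕ, j < 2 ^ k → y (j * h) ∈ Metric.ball q ρ := by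
    intro j hj
    have hj' : (j : ℝ) * h ≤ T := by
      rw [← hkT]
      have : (j : ℝ) ≤ 2 ^ k := by exact_mod_cast hj.le
      gcongr
    have h0 : 0 ≤ (j : ℝ) * h := by positivity
    have h1 := hlip 0 (j * h) le_rfl h0
    rw [Metric.mem_ball, dist_eq_norm]
    have h2 : V * ((j : ℝ) * h - 0) ≤ V * T := by
      rw [sub_zero]; gcongr
    have h3 : 0 ≤ V * T := by positivity
    calc ‖y (j * h) - q‖ = ‖(y (j * h) - y 0) + (y 0 - q)‖ := by congr 1; abel
      _ ≤ _ := norm_add_le _ _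
      _ < ρ := by linarith
  have key : ∀ j : ℕ, j ≤ 2 ^ k → Metric.infDist (y (j * h)) G.D ^ 2 ≤
      Metric.infDist (y 0) G.D ^ 2 - j * (2 * ε * (h - h ^ 2) - V ^ 2 * h ^ 2) := by
    intro j
    induction j with
    | zero => intro _; simp
    | succ j ih =>
      intro hj
      have h1 := G.infDist_sq_step_le hD (z := y (j * h)) (z' := y (((j : ℝ) + 1) * h)) (V := V)
        hε.le hh0 rfl (hsep _ (hpos j hj) _ (hdy k j hj)) (by
          have := hlip (j * h) (((j : ℝ) + 1) * h) (by positivity) (by gcongr; linarith)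
          refine this.trans_eq ?_
          ring)
      have h2 := ih (by omega)
      push_cast
      linarith
  have h1 := key (2 ^ k) le_rfl
  push_cast at h1
  rw [hkT] at h1
  have h2 : (2 : ℝ) ^ k * (2 * ε * (h - h ^ 2) - V ^ 2 * h ^ 2) =
      2 * ε * T - T * (h * (2 * ε + V ^ 2)) := by
    rw [← hkT]; ring
  rw [h2] at h1
  nlinarith [mul_le_mul_of_nonneg_left hk hT.le]

end Descent

/-! ### Convergence to the target off the exceptional set -/

section Approachability

variable {S Up Ua : Type*} [Fintype S] [Fintype Up] [Fintype Ua]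
  [Nonempty S] [Nonempty Up] [Nonempty Ua] {d : ℕ} {G : Game S Up Ua d}

namespace Scheme

variable (C : Scheme G)
variable (hK : IsCompact G.K) (hDK : G.D ⊆ G.K) (hD : G.D.Nonempty)
variable {x : ℕ → Vec d} (hx : ∀ n, x n ∈ G.K)
variable (hV : ∀ n, ‖x (n + 1) - x n‖ ≤ G.vmax * (1 / ((n : ℝ) + 1)))

include hK hDK hD hx hV in
/-- Holding periods with a given centre eventually bring the average closer to the target, by a
fixed amount. -/
theorem eventually_infDist_sq_le_of_centre (hN : x ∉ C.exceptional) {q : Vec d}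
    (hqC : q ∈ C.centres) :
    ∃ δ > 0, ∀ᶠ m in atTop, x (C.switchTime x m) ∈ G.K \ closure G.D →
      C.Q (x (C.switchTime x m)) = q →
      Metric.infDist (x (C.switchTime x (m + 1))) G.D ^ 2 ≤
        Metric.infDist (x (C.switchTime x m)) G.D ^ 2 - δ := by
  obtain ⟨ε, hε, hsep⟩ := C.separates q (C.centres_subset hD hqC)
  have hT := C.T_pos hK hDK hD hqC
  have hv := Game.vmax_nonneg hK (hx 0)
  -- Half of the drop in the limit: if periods violating this bound recurred, a limit of them would
  -- drop by at most εT/2, while every such limit drops by at least εT.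
  refine ⟨ε * C.T q / 2, by positivity, ?_⟩
  by_contra hcon
  rw [not_eventually] at hcon
  obtain ⟨m₀, hm₀, hm₀'⟩ := extraction_of_frequently_atTop hcon
  simp only [Classical.not_imp, not_le] at hm₀'
  -- Discarding early terms makes all holding lengths at most T(q) + 1, the common freezing time
  -- needed for compactness.
  have hev := (C.tendsto_holdingLength hK hDK hD hx hm₀
    fun n => ⟨(hm₀' n).1, (hm₀' n).2.1⟩).eventually (gt_mem_nhds (lt_add_one (C.T q)))
  obtain ⟨n₀, hn₀⟩ := eventually_atTop.1 hev
  set m₁ : ℕ → ℕ := fun n => m₀ (n + n₀) with hm₁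
  obtain ⟨R, hR⟩ := hK.isBounded.exists_norm_le
  obtain ⟨φ, hφ, y, hy⟩ := exists_subseq_tendstoUniformlyOn
    (f := fun n => C.trajectory x (m₁ n)) (B := C.T q + 1) (R := R) hv (by positivity)
    (fun n s t hs hst => C.norm_trajectory_sub_le hK hDK hD hx hV (m₁ n) hs hst)
    (fun n => by rw [C.trajectory_zero hK hDK hD hx]; exact hR _ (hx _))
    (fun n t ht => by
      have h1 := (hn₀ (n + n₀) (by omega)).le
      rw [C.trajectory_of_le (h1.trans ht), C.trajectory_of_le h1])
  set m : ℕ → ℕ := fun n => m₁ (φ n) with hmdef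
  have hm : StrictMono m := fun a b hab => hm₀ (by
    have := hφ hab
    omega)
  have hq : ∀ n, x (C.switchTime x (m n)) ∈ G.K \ closure G.D ∧
      C.Q (x (C.switchTime x (m n))) = q := fun n => ⟨(hm₀' _).1, (hm₀' _).2.1⟩
  have hyt : ∀ t, 0 ≤ t → Tendsto (fun n => C.trajectory x (m n) t) atTop (𝓝 (y t)) :=
    fun t ht => (hy t).tendsto_at ⟨ht, le_rfl⟩
  have hlip : ∀ s t, 0 ≤ s → s ≤ t → ‖y t - y s‖ ≤ G.vmax * (t - s) := fun s t hs hst =>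
    le_of_tendsto ((hyt t (hs.trans hst)).sub (hyt s hs)).norm
      (Eventually.of_forall fun n => C.norm_trajectory_sub_le hK hDK hD hx hV (m n) hs hst)
  have hlim0 : Tendsto (fun n => x (C.switchTime x (m n))) atTop (𝓝 (y 0)) :=
    (hyt 0 le_rfl).congr fun n => C.trajectory_zero hK hDK hD hx (m n)
  -- Periods end at their holding length, not exactly at T(q); the Lipschitz bound absorbs the
  -- vanishing discrepancy.
  have hlimT : Tendsto (fun n => x (C.switchTime x (m n + 1))) atTop (𝓝 (y (C.T q))) := by
    have hlen := C.tendsto_holdingLength hK hDK hD hx hm hq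
    have h1 : Tendsto (fun n => G.vmax * |C.holdingLength x (m n) - C.T q|) atTop (𝓝 0) := by
      have := ((hlen.sub_const (C.T q)).abs).const_mul G.vmax
      simpa using this
    have h2 : ∀ n, ‖x (C.switchTime x (m n + 1)) - C.trajectory x (m n) (C.T q)‖ ≤
        G.vmax * |C.holdingLength x (m n) - C.T q| := by
      intro n
      have hl := C.holdingLength_pos hK hDK hD hx (m n)
      rw [← C.trajectory_of_le (x := x) (m := m n) le_rfl]
      rcases le_total (C.T q) (C.holdingLength x (m n)) with h | h
      · rw [abs_of_nonneg (sub_nonneg.2 h)]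
        exact C.norm_trajectory_sub_le hK hDK hD hx hV (m n) hT.le h
      · rw [norm_sub_rev, abs_sub_comm, abs_of_nonneg (sub_nonneg.2 h)]
        exact C.norm_trajectory_sub_le hK hDK hD hx hV (m n) hl.le h
    have := (squeeze_zero_norm h2 h1).add (hyt _ hT.le)
    rw [zero_add] at this
    exact this.congr fun n => by abel
  have hy0 : ‖y 0 - q‖ ≤ C.ρ q / 2 := by
    refine le_of_tendsto (hlim0.sub_const q).norm (Eventually.of_forall fun n => ?_)
    have := (C.Q_spec hD (hq n).1).2.1
    rw [(hq n).2, Metric.mem_ball, dist_eq_norm] at this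
    exact this.le
  have hdrop := infDist_sq_le_of_dyadicReward hD (A := closure (G.rewardSet (C.strat q))) hT hε hv
    hlip hy0 (C.vmax_mul_T_lt hK hDK hD hqC) ?_ ?_
  · have hcont : Continuous fun z : Vec d => Metric.infDist z G.D ^ 2 :=
      (Metric.continuous_infDist_pt G.D).pow 2
    have h1 := ((hcont.tendsto _).comp hlim0).sub_const (ε * C.T q / 2)
    have h2 := (hcont.tendsto _).comp hlimT
    have h3 := le_of_tendsto_of_tendsto' h1 h2 fun n => (hm₀' (φ n + n₀)).2.2.le
    have : 0 < ε * C.T q := by positivity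
    linarith
  · intro z hz r hr
    -- Separation is a closed condition on r, so it passes from R(π^p_q) to its closure.
    have hclosed : IsClosed {r : Vec d | ε ≤ inner ℝ (r - G.proj z) (G.proj z - z)} :=
      isClosed_le continuous_const (by fun_prop)
    refine closure_minimal ?_ hclosed hr
    rintro _ ⟨πa, rfl⟩
    exact hsep z hz πa
  · intro k j hj
    by_contra hnot
    refine hN ?_
    simp only [exceptional, Set.mem_iUnion, Finset.mem_range]
    exact ⟨q, hqC, k, j, hj, m, hm, hq, y, hy, hnot⟩

include hK hDK hD hx hV in
-- Only finitely many centres serve points at distance at least c, so one positive δ lies below all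
-- of their individual drops.
theorem eventually_infDist_sq_le (hN : x ∉ C.exceptional) {c : ℝ} (hc : 0 < c) :
    ∃ δ > 0, ∀ᶠ m in atTop, c ≤ Metric.infDist (x (C.switchTime x m)) G.D →
      Metric.infDist (x (C.switchTime x (m + 1))) G.D ^ 2 ≤
        Metric.infDist (x (C.switchTime x m)) G.D ^ 2 - δ := by
  have hmem : ∀ z ∈ G.K, c ≤ Metric.infDist z G.D → z ∈ G.K \ closure G.D := fun z hz hcz =>
    ⟨hz, fun h => by
      rw [Metric.mem_closure_iff_infDist_zero hD] at h
      linarith⟩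
  have hfin := C.finite_Q_image hD hc
  have hqs : ∀ q ∈ C.Q '' {z ∈ G.K | c ≤ Metric.infDist z G.D}, ∃ δ > 0, ∀ᶠ m in atTop,
      x (C.switchTime x m) ∈ G.K \ closure G.D → C.Q (x (C.switchTime x m)) = q →
      Metric.infDist (x (C.switchTime x (m + 1))) G.D ^ 2 ≤
        Metric.infDist (x (C.switchTime x m)) G.D ^ 2 - δ := by
    rintro q ⟨z, ⟨hz, hcz⟩, rfl⟩
    exact C.eventually_infDist_sq_le_of_centre hK hDK hD hx hV hN
      (C.Q_spec hD (hmem z hz hcz)).1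
  choose! δ hδ hev using hqs
  have hδ' : ∀ᶠ r in 𝓝[>] (0 : ℝ), ∀ q ∈ C.Q '' {z ∈ G.K | c ≤ Metric.infDist z G.D}, r ≤ δ q :=
    (eventually_all_finite hfin).2 fun q hq =>
      mem_nhdsWithin_of_mem_nhds (ge_mem_nhds (hδ q hq))
  obtain ⟨r, hr, hr0⟩ := (hδ'.and self_mem_nhdsWithin).exists
  refine ⟨r, hr0, ?_⟩
  filter_upwards [(eventually_all_finite hfin).2 hev] with m hm hcm
  have hq : C.Q (x (C.switchTime x m)) ∈ C.Q '' {z ∈ G.K | c ≤ Metric.infDist z G.D} :=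
    ⟨_, ⟨hx _, hcm⟩, rfl⟩
  have h1 := hm _ hq (hmem _ (hx _) hcm) rfl
  have h2 := hr _ hq
  linarith

include hK hDK hD hx hV in
/-- During a holding period the distance to the target grows at most by a constant factor, up to a
vanishing error. -/
theorem infDist_le_of_mem_period {m n : ℕ} (h1 : 1 ≤ C.switchTime x m)
    (hmn : C.switchTime x m ≤ n) (hnm : n ≤ C.switchTime x (m + 1)) :
    Metric.infDist (x n) G.D ≤ 5 / 3 * Metric.infDist (x (C.switchTime x m)) G.D +
      G.vmax * (1 / (C.switchTime x m : ℝ)) := by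
  have hv := Game.vmax_nonneg hK (hx 0)
  set s := C.switchTime x m with hs
  have hspos : (0 : ℝ) < s := by exact_mod_cast h1
  have hmove : ‖x n - x s‖ ≤ G.vmax * C.holdingLength x m := by
    refine (norm_sub_le_of_step hV hmn).trans (mul_le_mul_of_nonneg_left ?_ hv)
    have := rescaledTime_strictMono.monotone hnm
    rw [holdingLength]
    linarith
  have htri : Metric.infDist (x n) G.D ≤ Metric.infDist (x s) G.D + ‖x n - x s‖ := by
    rw [← dist_eq_norm]
    exact Metric.infDist_le_infDist_add_dist
  have hnn : 0 ≤ Metric.infDist (x s) G.D := Metric.infDist_nonneg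
  by_cases hsD : x s ∈ closure G.D
  · have hlen : C.holdingLength x m ≤ 1 / (s : ℝ) := by
      have e : C.switchTime x (m + 1) = s + 1 := by
        change C.nextSwitch x s = s + 1
        rw [nextSwitch, if_pos hsD]
      rw [holdingLength, e, rescaledTime_succ, ← hs, add_sub_cancel_left]
      gcongr
      linarith
    have := mul_le_mul_of_nonneg_left hlen hv
    linarith
  -- Here ρ ≤ dist(q, D) ≤ dist(x_s, D) + ρ/2, so ρ ≤ 2 dist(x_s, D). The displacement is at most
  -- ρ/3 plus an error, which accounts for 5/3 = 1 + 2/3.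
  · obtain ⟨hqC, hball, -⟩ := C.Q_spec hD ⟨hx s, hsD⟩
    have hlen := (abs_le.1 (C.abs_holdingLength_sub_le hK hDK hD hx hsD h1)).2
    have hVT := C.vmax_mul_T_lt hK hDK hD hqC
    have hρ := C.ρ_le_infDist hD hqC
    have hq : Metric.infDist (C.Q (x s)) G.D ≤
        Metric.infDist (x s) G.D + dist (C.Q (x s)) (x s) := Metric.infDist_le_infDist_add_dist
    rw [Metric.mem_ball, dist_comm] at hball
    have h2 : G.vmax * C.holdingLength x m ≤
        G.vmax * C.T (C.Q (x s)) + G.vmax * (1 / (s : ℝ)) := by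
      rw [← mul_add]
      refine mul_le_mul_of_nonneg_left ?_ hv
      linarith
    linarith

include hK hDK hD hx hV in
/-- Along a sequence that is not exceptional the distance to the target vanishes. -/
theorem tendsto_infDist (hN : x ∉ C.exceptional) :
    Tendsto (fun n => Metric.infDist (x n) G.D) atTop (𝓝 0) := by
  have hmono := C.switchTime_strictMono hK hDK hD hx
  -- Switching times stay below 2c eventually; within a period the bound is then 5/3 · 2c + c/3 ≤
  -- 4c.
  have key : ∀ c : ℝ, 0 < c → ∀ᶠ n in atTop, Metric.infDist (x n) G.D ≤ 4 * c := by
    intro c hc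
    obtain ⟨δ, hδ, hev⟩ := C.eventually_infDist_sq_le hK hDK hD hx hV hN hc
    have hsmall : ∀ᶠ m in atTop, G.vmax * (1 / (C.switchTime x m : ℝ)) ≤ c / 3 := by
      have : Tendsto (fun m => G.vmax * (1 / (C.switchTime x m : ℝ))) atTop (𝓝 0) := by
        simpa using (tendsto_one_div_atTop_nhds_zero_nat.comp hmono.tendsto_atTop).const_mul G.vmax
      exact this.eventually (ge_mem_nhds (by positivity))
    obtain ⟨m₀, hm₀⟩ := eventually_atTop.1 ((hev.and hsmall).and
      (hmono.tendsto_atTop.eventually_ge_atTop 1))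
    -- If the distance stayed at c or more, its square would fall by δ forever and become negative.
    obtain ⟨m₁, hm₁, hlt⟩ : ∃ m₁ ≥ m₀, Metric.infDist (x (C.switchTime x m₁)) G.D < c := by
      by_contra! hcon
      have hdec : ∀ k : ℕ, Metric.infDist (x (C.switchTime x (m₀ + k))) G.D ^ 2 ≤
          Metric.infDist (x (C.switchTime x m₀)) G.D ^ 2 - k * δ := by
        intro k
        induction k with
        | zero => simp
        | succ k ih =>
          have := (hm₀ (m₀ + k) (by omega)).1.1 (hcon (m₀ + k) (by omega))
          rw [← add_assoc]
          push_cast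
          linarith
      obtain ⟨k, hk⟩ := exists_nat_gt (Metric.infDist (x (C.switchTime x m₀)) G.D ^ 2 / δ)
      rw [div_lt_iff₀ hδ] at hk
      have h1 := hdec k
      have h2 : 0 ≤ Metric.infDist (x (C.switchTime x (m₀ + k))) G.D ^ 2 := sq_nonneg _
      linarith
    -- From below c a period reaches at most 5c/3 + c/3 = 2c; from c or above the distance
    -- decreases.
    have hstay : ∀ m, m₁ ≤ m → Metric.infDist (x (C.switchTime x m)) G.D ≤ 2 * c := by
      intro m hm
      induction m, hm using Nat.le_induction with
      | base => linarith
      | succ m hm ih =>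
        obtain ⟨⟨h1, h2⟩, h3⟩ := hm₀ m (by omega)
        rcases lt_or_ge (Metric.infDist (x (C.switchTime x m)) G.D) c with h | h
        · have := C.infDist_le_of_mem_period hK hDK hD hx hV h3 (hmono m.lt_succ_self).le le_rfl
          linarith
        · refine (pow_le_pow_iff_left₀ Metric.infDist_nonneg (by positivity) two_ne_zero).1 ?_
          have h4 := pow_le_pow_left₀ Metric.infDist_nonneg ih 2
          have h5 := h1 h
          linarith
    have hperiod : ∀ n, C.switchTime x m₁ ≤ n →
        ∃ m ≥ m₁, C.switchTime x m ≤ n ∧ n < C.switchTime x (m + 1) := by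
      intro n hn
      induction n, hn using Nat.le_induction with
      | base => exact ⟨m₁, le_rfl, le_rfl, hmono m₁.lt_succ_self⟩
      | succ n hn ih =>
        obtain ⟨m, hm, h1, h2⟩ := ih
        rcases (Nat.succ_le_of_lt h2).eq_or_lt with h | h
        · exact ⟨m + 1, by omega, h.ge, h.trans_lt (hmono (m + 1).lt_succ_self)⟩
        · exact ⟨m, hm, by omega, h⟩
    filter_upwards [eventually_ge_atTop (C.switchTime x m₁)] with n hn
    obtain ⟨m, hm, h1, h2⟩ := hperiod n hn
    have h3 := hm₀ m (by omega)
    have h4 := C.infDist_le_of_mem_period hK hDK hD hx hV h3.2 h1 h2.le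
    have h5 := hstay m hm
    linarith [h3.1.2]
  rw [Metric.tendsto_nhds]
  intro ε hε
  filter_upwards [key (ε / 8) (by positivity)] with n hn
  rw [Real.dist_0_eq_abs, abs_of_nonneg Metric.infDist_nonneg]
  linarith

include hK hDK hD hx hV in
theorem mem_closure_of_mapClusterPt (hN : x ∉ C.exceptional) {z : Vec d}
    (hz : MapClusterPt z atTop x) : z ∈ closure G.D := by
  by_contra hzD
  have hpos := Game.infDist_pos hD hzD
  have h1 : ∀ᶠ y in 𝓝 z, Metric.infDist z G.D / 2 < Metric.infDist y G.D :=
    (Metric.continuous_infDist_pt G.D).continuousAt.eventually (lt_mem_nhds (half_lt_self hpos))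
  have h2 := (C.tendsto_infDist hK hDK hD hx hV hN).eventually (gt_mem_nhds (half_pos hpos))
  obtain ⟨n, h3, h4⟩ := ((hz.frequently h1).and_eventually h2).exists
  exact absurd h3 (not_lt.2 h4.le)

end Scheme

end Approachability

/-! ### Existence of a scheme -/

section Existence

variable {S Up Ua : Type*} [Fintype S] {d : ℕ} {G : Game S Up Ua d}

namespace Game

/-- Variational characterization of the nearest point; this is where convexity of the closure
enters. -/
theorem inner_sub_proj_nonpos (hD : G.D.Nonempty) (hconv : Convex ℝ (closure G.D)) (x : Vec d)
    {w : Vec d} (hw : w ∈ closure G.D) : inner ℝ (x - G.proj x) (w - G.proj x) ≤ 0 := by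
  obtain ⟨hmem, hmin⟩ := proj_spec hD x
  refine (norm_eq_iInf_iff_real_inner_le_zero hconv hmem).1 ?_ w hw
  have : Nonempty (closure G.D) := hD.closure.to_subtype
  refine le_antisymm (le_ciInf fun z => hmin z z.2) ?_
  exact ciInf_le (f := fun z : closure G.D => ‖x - z‖)
    ⟨0, by rintro _ ⟨z, rfl⟩; exact norm_nonneg _⟩ ⟨_, hmem⟩

/-- Add the variational inequalities at the two projections and apply Cauchy–Schwarz. -/
theorem norm_proj_sub_proj_le (hD : G.D.Nonempty) (hconv : Convex ℝ (closure G.D)) (x y : Vec d) :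
    ‖G.proj x - G.proj y‖ ≤ ‖x - y‖ := by
  have h1 := inner_sub_proj_nonpos hD hconv x (proj_spec hD y).1
  have h2 := inner_sub_proj_nonpos hD hconv y (proj_spec hD x).1
  have h3 : ‖G.proj x - G.proj y‖ ^ 2 ≤ inner ℝ (x - y) (G.proj x - G.proj y) := by
    have e : x - y = (x - G.proj x) + (G.proj x - G.proj y) - (y - G.proj y) := by abel
    have e1 : G.proj y - G.proj x = -(G.proj x - G.proj y) := by abel
    rw [e1, inner_neg_right] at h1
    rw [e, inner_sub_left, inner_add_left, real_inner_self_eq_norm_sq]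
    linarith
  have h4 := real_inner_le_norm (x - y) (G.proj x - G.proj y)
  rcases (norm_nonneg (G.proj x - G.proj y)).eq_or_lt with h | h
  · rw [← h]; exact norm_nonneg _
  · nlinarith

theorem continuous_proj (hD : G.D.Nonempty) (hconv : Convex ℝ (closure G.D)) :
    Continuous G.proj :=
  (LipschitzWith.of_dist_le_mul (K := 1) fun x y => by
    simpa [dist_eq_norm] using norm_proj_sub_proj_le hD hconv x y).continuous

theorem isCompact_layer (hK : IsCompact G.K) (n : ℕ) : IsCompact (G.layer n) := by
  have h1 : IsClosed {y : Vec d | 1 / ((n : ℝ) + 1) ≤ Metric.infDist y G.D} :=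
    isClosed_le continuous_const (Metric.continuous_infDist_pt _)
  have h2 : IsClosed {y : Vec d | n ≠ 0 → Metric.infDist y G.D ≤ 1 / (n : ℝ)} := by
    by_cases hn : n = 0
    · simp [hn]
    · simpa [hn] using isClosed_le (Metric.continuous_infDist_pt G.D) continuous_const
  exact hK.inter_right (h1.inter h2)

variable [Fintype Up] [Fintype Ua]

/-- A bound uniform in the adversary's strategy, so that the separation radius can be chosen
independently of it. -/
theorem norm_meanReward_le (πp : Strategy S Up) (πa : Strategy S Ua) :
    ‖G.meanReward πp πa‖ ≤ ∑ θ, ∑ a, ∑ b, ‖G.κ θ a b‖ := by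
  have hst : ∀ θ, G.stationary πp πa θ ∈ Set.Icc (0 : ℝ) 1 := by
    intro θ
    rw [stationary]
    split_ifs with h
    · exact mem_Icc_of_mem_stdSimplex h.choose_spec.1 θ
    · simp
  refine (norm_sum_le _ _).trans (Finset.sum_le_sum fun θ _ => (norm_sum_le _ _).trans
    (Finset.sum_le_sum fun a _ => (norm_sum_le _ _).trans (Finset.sum_le_sum fun b _ => ?_)))
  have ha : πp θ a ∈ Set.Icc (0 : ℝ) 1 := mem_Icc_of_mem_stdSimplex (πp θ).2 a
  have hb : πa θ b ∈ Set.Icc (0 : ℝ) 1 := mem_Icc_of_mem_stdSimplex (πa θ).2 b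
  have hs := hst θ
  rw [norm_smul, Real.norm_of_nonneg (mul_nonneg (mul_nonneg hs.1 ha.1) hb.1)]
  exact mul_le_of_le_one_left (norm_nonneg _)
    (mul_le_one₀ (mul_le_one₀ hs.2 ha.1 ha.2) hb.1 hb.2)

/-- Separation at a point extends to a ball around it. -/
theorem exists_radius (hD : G.D.Nonempty) (hconv : Convex ℝ (closure G.D)) {x : Vec d}
    {πp : Strategy S Up} {ε : ℝ} (hε : 0 < ε)
    (h : ∀ πa : Strategy S Ua, ε ≤ inner ℝ (G.meanReward πp πa - G.proj x) (G.proj x - x)) :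
    ∃ ρ > 0, ∃ ε > 0, ∀ y ∈ Metric.ball x ρ, ∀ πa : Strategy S Ua,
      ε ≤ inner ℝ (G.meanReward πp πa - G.proj y) (G.proj y - y) := by
  set B := ∑ θ, ∑ a, ∑ b, ‖G.κ θ a b‖ with hB
  have hcont := continuous_proj hD hconv
  -- F dominates the change of the inner product between x and y for all adversary strategies at
  -- once, and it vanishes at x.
  let F : Vec d → ℝ := fun y => B * ‖(G.proj y - y) - (G.proj x - x)‖ +
    |inner ℝ (G.proj y) (G.proj y - y) - inner ℝ (G.proj x) (G.proj x - x)|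
  have hF : Continuous F := by fun_prop
  have hFx : F x = 0 := by simp [F]
  have hev : ∀ᶠ y in 𝓝 x, F y < ε / 2 :=
    hF.continuousAt.eventually (gt_mem_nhds (by rw [hFx]; positivity))
  obtain ⟨ρ, hρ, hball⟩ := Metric.eventually_nhds_iff_ball.1 hev
  refine ⟨ρ, hρ, ε / 2, by positivity, fun y hy πa => ?_⟩
  have h1 := hball y hy
  have h2 := h πa
  set r := G.meanReward πp πa with hr
  have e : inner ℝ (r - G.proj y) (G.proj y - y) = inner ℝ (r - G.proj x) (G.proj x - x) +
      inner ℝ r ((G.proj y - y) - (G.proj x - x)) -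
      (inner ℝ (G.proj y) (G.proj y - y) - inner ℝ (G.proj x) (G.proj x - x)) := by
    rw [inner_sub_left, inner_sub_left, inner_sub_right r (G.proj y - y)]
    ring
  have h3 : -(B * ‖(G.proj y - y) - (G.proj x - x)‖) ≤
      inner ℝ r ((G.proj y - y) - (G.proj x - x)) := by
    refine (neg_le_neg ?_).trans (neg_le_of_abs_le (abs_real_inner_le_norm _ _))
    exact mul_le_mul_of_nonneg_right (norm_meanReward_le πp πa) (norm_nonneg _)
  have h4 := le_abs_self
    (inner ℝ (G.proj y) (G.proj y - y) - inner ℝ (G.proj x) (G.proj x - x))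
  rw [e]
  simp only [F] at h1
  linarith

end Game

theorem Scheme.nonempty_of_separation [Fintype Up] [Fintype Ua] [Nonempty S] [Nonempty Up]
    [Nonempty Ua] (hK : IsCompact G.K) (hDK : G.D ⊆ G.K) (hD : G.D.Nonempty)
    (hconv : Convex ℝ (closure G.D)) (hsep : G.Separation) : Nonempty (Scheme G) := by
  have H : ∀ x ∈ G.K \ closure G.D, ∃ πp : Strategy S Up, ∃ ρ > 0, ∃ ε > 0,
      ∀ y ∈ Metric.ball x ρ, ∀ πa : Strategy S Ua,
        ε ≤ inner ℝ (G.meanReward πp πa - G.proj y) (G.proj y - y) := by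
    intro x hx
    obtain ⟨πp, ε, hε, h⟩ := hsep x hx
    exact ⟨πp, Game.exists_radius hD hconv hε h⟩
  choose! strat ρ hρ hstrat using H
  have hnet : ∀ n, ∃ t : Finset (Vec d), (∀ q ∈ t, q ∈ G.layer n) ∧
      G.layer n ⊆ ⋃ q ∈ t, Metric.ball q (ρ q / 2) := fun n =>
    (Game.isCompact_layer hK n).elim_nhds_subcover (fun q => Metric.ball q (ρ q / 2)) fun q hq =>
      Metric.ball_mem_nhds q (half_pos (hρ q (Game.layer_subset hD n hq)))
  choose net hnet1 hnet2 using hnet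
  obtain ⟨index, hindex⟩ := Set.countable_iff_exists_injOn.1
    (Set.countable_iUnion fun n => (net n).countable_toSet)
  refine ⟨{
    strat := strat
    strat₀ := Classical.arbitrary _
    ρ := ρ
    ρ_pos := hρ
    separates := hstrat
    net := net
    net_subset := hnet1
    net_covers := hnet2
    index := index
    index_injOn := hindex
    -- The constant 7/24 is the midpoint of 1/4 and 1/3.
    T := fun q => 7 / 24 * (ρ q / G.vmax)
    T_bounds := fun q hq => ?_ }⟩
  obtain ⟨n, hn⟩ := Set.mem_iUnion.1 hq
  have hqK := Game.layer_subset hD n (hnet1 n q hn)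
  have hpos : 0 < ρ q / G.vmax := div_pos (hρ q hqK) (Game.vmax_pos hK hDK hD hqK)
  have e1 : ρ q / (4 * G.vmax) = 1 / 4 * (ρ q / G.vmax) := by rw [mul_comm 4, ← div_div]; ring
  have e2 : ρ q / (3 * G.vmax) = 1 / 3 * (ρ q / G.vmax) := by rw [mul_comm 3, ← div_div]; ring
  rw [e1, e2]
  constructor <;> linarith

end Existence

end Approach

end

theorem mainTheorem1 {S Up Ua : Type*} [Fintype S] [Fintype Up] [Fintype Ua]
    [Nonempty S] [Nonempty Up] [Nonempty Ua] {d : ℕ} (G : Approach.Game S Up Ua d)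
    (hK : IsCompact G.K)
    (hκ : convexHull ℝ {r | ∃ θ a b, r = G.κ θ a b} ⊆ G.K)
    (hDK : G.D ⊆ G.K) (hD : G.D.Nonempty) (hconv : Convex ℝ (closure G.D))
    (hergodic : G.Ergodic) (hsep : G.Separation) :
    Nonempty (Approach.Scheme G) ∧
    ∀ (C : Approach.Scheme G) {Ω : Type*} [mΩ : MeasurableSpace Ω]
      (μ : Measure Ω) [IsProbabilityMeasure μ] (ℱ : Filtration ℕ mΩ)
      (x₀ : Approach.Vec d) (θ : ℕ → Ω → S) (up : ℕ → Ω → Up) (ua : ℕ → Ω → Ua)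
      (πa : ℕ → Ω → Approach.Strategy S Ua),
      x₀ ∈ G.K → C.IsPlay μ ℱ x₀ θ up ua πa →
        (∀ᵐ ω ∂μ, C.path x₀ θ up ua ω ∉ C.exceptional) ∧
        (∀ ω, C.path x₀ θ up ua ω ∉ C.exceptional →
          ∀ x, MapClusterPt x atTop (C.path x₀ θ up ua ω) → x ∈ closure G.D) := by
  refine ⟨Approach.Scheme.nonempty_of_separation hK hDK hD hconv hsep, ?_⟩
  intro C Ω mΩ μ _ ℱ x₀ θ up ua πa hx₀ hplay
  refine ⟨C.ae_notMem_exceptional hK hDK hD hκ hergodic hx₀ hplay, fun ω hω x hcluster => ?_⟩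
  exact C.mem_closure_of_mapClusterPt hK hDK hD (C.path_mem hκ hx₀ θ up ua ω)
    (C.norm_path_succ_sub_le hK hκ hx₀ θ up ua ω) hω hcluster
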